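/- Let $p$ be a prime. Let $L_t\cup P$ be the one-sorted language $\{0,1,+,\cdot,t\}$ together with a unary predicate $P$, and view each ring $\mathbb{F}_p[t]/(t^n)$, $n\in\mathbb{N}$, as an $L_t\cup P$-structure in which the constant $t$ is the class of $t$ and $P$ is the set $\{0,1,t,\dots,t^{n-1}\}$. Let $L_{\mathrm{val},\times}$ be the three-sorted language of valued fields with a cross-section: sorts $\mathbf{K}$ (field) and $\mathbf{k}$ (residue field), each with symbols $0,1,+,\cdot$; a sort $\mathbf{\Gamma}$ (value group together with $\infty$) with symbols $0,+,<,\infty$; and function symbols $v:\mathbf{K}\to\mathbf{\Gamma}$ for the valuation, $\mathrm{res}:\mathbf{K}\to\mathbf{k}$ for the residue map (with $\mathrm{res}(x)=0$ if $v(x)<0$) and $s:\mathbf{\Gamma}\to\mathbf{K}$ for a cross-section, that is, a group homomorphism $s:\Gamma\to K^\times$ with $v\circ s=\mathrm{id}_\Gamma$, extended by $s(\infty)=0$. For every totally ramified finite extension $K/\mathbb{Q}_p$ inside a fixed algebraic closure of $\mathbb{Q}_p$, that is, $[K:\mathbb{Q}_p]=e(K/\mathbb{Q}_p)<\infty$,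 fix an arbitrary cross-section $s_K$, and view $K$, equipped with $s_K$, as an $L_{\mathrm{val},\times}$-structure. Then the set of existential $L_t\cup P$-sentences that are true in $\mathbb{F}_p[t]/(t^n)$ for all but finitely many $n\in\mathbb{N}$ is Turing reducible to the set of $\exists\forall$-sentences of $L_{\mathrm{val},\times}$ that are true in all but finitely many totally ramified finite extensions $K$ of $\mathbb{Q}_p$. Here an existential sentence (respectively an $\exists\forall$-sentence) is a sentence consisting of a block of existential quantifiers (respectively a block of existential quantifiers followed by a block of universal quantifiers) in front of a quantifier-free formula, where blocks may be empty, and sentences are identified with natural numbers through standard Gödel numberings. -/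

import Mathlib

open FirstOrder

/-! ## The one-sorted language `L_t ∪ {P}` and the rings `𝔽_p[t]/(t^n)` -/

/-- Function symbols of `L_t = {0, 1, +, ·, t}`. -/
inductive LtFunc : ℕ → Type
  | zero : LtFunc 0
  | one : LtFunc 0
  | t : LtFunc 0
  | add : LtFunc 2
  | mul : LtFunc 2

/-- The unary predicate symbol `P`. -/
inductive LtRel : ℕ → Type
  | P : LtRel 1

/-- The language `L_t ∪ {P}`. -/
def LtP : FirstOrder.Language.{0, 0} := ⟨LtFunc, LtRel⟩

/-- The ring `𝔽_p[t]/(t^n)`. -/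
abbrev TruncPoly (p n : ℕ) : Type :=
  Polynomial (ZMod p) ⧸ Ideal.span {(Polynomial.X : Polynomial (ZMod p)) ^ n}

/-- The class of `t` in `𝔽_p[t]/(t^n)`. -/
noncomputable def TruncPoly.t (p n : ℕ) : TruncPoly p n :=
  Ideal.Quotient.mk _ Polynomial.X

/-- `𝔽_p[t]/(t^n)` as an `L_t ∪ {P}`-structure, `P` being the set `{0, 1, t, …, t^(n-1)}`. -/
noncomputable instance TruncPoly.structure (p n : ℕ) : LtP.Structure (TruncPoly p n) where
  funMap := fun f => match f with
    | LtFunc.zero => fun _ => 0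
    | LtFunc.one => fun _ => 1
    | LtFunc.t => fun _ => TruncPoly.t p n
    | LtFunc.add => fun x => x 0 + x 1
    | LtFunc.mul => fun x => x 0 * x 1
  RelMap := fun r => match r with
    | LtRel.P => fun x => x 0 = 0 ∨ ∃ k < n, x 0 = TruncPoly.t p n ^ k

/-- The asymptotic existential theory of `{𝔽_p[t]/(t^n) : n ∈ ℕ}`: the existential
`L_t ∪ {P}`-sentences that are true in `𝔽_p[t]/(t^n)` for all but finitely many `n`. -/
def asymptoticExistentialTheory (p : ℕ) : Set LtP.Sentence :=
  {φ | FirstOrder.Language.BoundedFormula.IsExistential φ ∧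
    ∀ᶠ n : ℕ in Filter.cofinite, TruncPoly p n ⊨ φ}

namespace LtP

/-! Gödel numbering of `L_t ∪ {P}`. -/

def funcCode : {l : ℕ} → LtFunc l → ℕ
  | _, LtFunc.zero => 0
  | _, LtFunc.one => 1
  | _, LtFunc.t => 2
  | _, LtFunc.add => 3
  | _, LtFunc.mul => 4

def termCode {n : ℕ} : LtP.Term (Empty ⊕ Fin n) → ℕ
  | .var (Sum.inl e) => e.elim
  | .var (Sum.inr i) => Nat.pair 0 i
  | .func f ts =>
      Nat.pair 1 (Nat.pair (funcCode f) (Encodable.encode (List.ofFn fun i => termCode (ts i))))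

/-- Variables are de Bruijn levels, as in `BoundedFormula`. `P` is the only relation symbol, so
its atoms are coded by their list of arguments alone. -/
def code : {n : ℕ} → LtP.BoundedFormula Empty n → ℕ
  | _, .falsum => Nat.pair 0 0
  | _, .equal t₁ t₂ => Nat.pair 1 (Nat.pair (termCode t₁) (termCode t₂))
  | _, .rel _ ts => Nat.pair 2 (Encodable.encode (List.ofFn fun i => termCode (ts i)))
  | _, .imp φ ψ => Nat.pair 3 (Nat.pair (code φ) (code ψ))
  | _, .all φ => Nat.pair 4 (code φ)

theorem termCode_inj {n : ℕ} : Function.Injective (LtP.termCode (n := n)) := by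
  intro x
  induction x with
  | var x =>
    rcases x with x | x
    · exact x.elim
    intro y h
    rcases y with (y|y) | ⟨f, ts⟩
    · exact y.elim
    · simp_all [LtP.termCode, Nat.pair_eq_pair, Fin.ext_iff]
    · simp_all [LtP.termCode, Nat.pair_eq_pair]
  | func f ts ih =>
    intro y h
    rcases y with (y|y) | ⟨g, us⟩
    · exact y.elim
    · simp_all [LtP.termCode, Nat.pair_eq_pair]
    · simp only [LtP.termCode, Nat.pair_eq_pair, Encodable.encode_inj, true_and] at h
      obtain ⟨h1, h2⟩ := h
      cases f <;> cases g <;> simp_all [LtP.funcCode]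
      all_goals
        first
          | (congr 1; funext i; exact i.elim0)
          | (congr 1; funext i; fin_cases i
             · exact ih.1 rfl
             · exact ih.2 rfl)

theorem code_inj {n : ℕ} : Function.Injective (LtP.code (n := n)) := by
  intro x
  induction x with
  | falsum => intro y h; cases y <;> simp_all [LtP.code, Nat.pair_eq_pair]
  | equal a b =>
    intro y h; cases y <;> simp_all [LtP.code, Nat.pair_eq_pair]
    exact ⟨LtP.termCode_inj h.1, LtP.termCode_inj h.2⟩
  | rel R ts =>
    intro y h
    cases y with
    | rel S us =>
      cases R; cases S
      simp_all [LtP.code, Nat.pair_eq_pair]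
      congr 1; funext i; fin_cases i; exact LtP.termCode_inj h
    | _ => simp_all [LtP.code, Nat.pair_eq_pair]
  | imp a b i1 i2 =>
    intro y h; cases y <;> simp_all [LtP.code, Nat.pair_eq_pair]
    exact ⟨i1 rfl, i2 rfl⟩
  | all a i1 =>
    intro y h; cases y <;> simp_all [LtP.code, Nat.pair_eq_pair]
    exact i1 rfl

end LtP

/-! ## The three-sorted language `L_{val,×}` of valued fields with a cross-section -/

namespace Lval

/-- The sorts: field, value group (with `∞`), residue field. -/
inductive Srt : Type
  | K
  | Γ
  | k

/-- Terms of `L_{val,×}`, with variables `x_0, x_1, …` of each sort: the field and the residue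
field carry `{0, 1, +, ·}`, the value group `{0, +, ∞}` (and the relation `<`), and there are
function symbols `v : K → Γ`, `res : K → k` and `s : Γ → K`. -/
inductive Term : Srt → Type
  | var (σ : Srt) (i : ℕ) : Term σ
  | zeroK : Term .K
  | oneK : Term .K
  | addK : Term .K → Term .K → Term .K
  | mulK : Term .K → Term .K → Term .K
  | zeroΓ : Term .Γ
  | inftyΓ : Term .Γ
  | addΓ : Term .Γ → Term .Γ → Term .Γ
  | zerok : Term .k
  | onek : Term .k
  | addk : Term .k → Term .k → Term .k
  | mulk : Term .k → Term .k → Term .k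
  | v : Term .K → Term .Γ
  | res : Term .K → Term .k
  | s : Term .Γ → Term .K

/-- Formulas of `L_{val,×}`; the other connectives are abbreviations, e.g. `¬ φ` is `φ → ⊥`. -/
inductive Formula : Type
  | falsum : Formula
  | eq {σ : Srt} (t₁ t₂ : Term σ) : Formula
  | lt (t₁ t₂ : Term .Γ) : Formula
  | imp (φ ψ : Formula) : Formula
  | all (σ : Srt) (i : ℕ) (φ : Formula) : Formula
  | ex (σ : Srt) (i : ℕ) (φ : Formula) : Formula

/-- The variables occurring in a term. -/
def Term.vars : {σ : Srt} → Term σ → Set (Srt × ℕ)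
  | _, var σ i => {(σ, i)}
  | _, addK a b | _, mulK a b | _, addΓ a b | _, addk a b | _, mulk a b => a.vars ∪ b.vars
  | _, v a | _, res a | _, s a => a.vars
  | _, zeroK | _, oneK | _, zeroΓ | _, inftyΓ | _, zerok | _, onek => ∅

/-- The free variables of a formula. -/
def Formula.freeVars : Formula → Set (Srt × ℕ)
  | falsum => ∅
  | eq a b => a.vars ∪ b.vars
  | lt a b => a.vars ∪ b.vars
  | imp φ ψ => φ.freeVars ∪ ψ.freeVars
  | all σ i φ => φ.freeVars \ {(σ, i)}
  | ex σ i φ => φ.freeVars \ {(σ, i)}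

def Formula.IsSentence (φ : Formula) : Prop := φ.freeVars = ∅

/-- Quantifier-free formulas. -/
inductive Formula.IsQF : Formula → Prop
  | falsum : IsQF falsum
  | eq {σ : Srt} (a b : Term σ) : IsQF (eq a b)
  | lt (a b : Term .Γ) : IsQF (lt a b)
  | imp {φ ψ : Formula} : IsQF φ → IsQF ψ → IsQF (imp φ ψ)

/-- `∀`-formulas: a block of universal quantifiers followed by a quantifier-free formula. -/
inductive Formula.IsUniversal : Formula → Prop
  | of_isQF {φ : Formula} : IsQF φ → IsUniversal φ
  | all (σ : Srt) (i : ℕ) {φ : Formula} : IsUniversal φ → IsUniversal (all σ i φ)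

/-- `∃∀`-formulas: a block of existential quantifiers followed by a `∀`-formula. -/
inductive Formula.IsExistsForall : Formula → Prop
  | of_isUniversal {φ : Formula} : IsUniversal φ → IsExistsForall φ
  | ex (σ : Srt) (i : ℕ) {φ : Formula} : IsExistsForall φ → IsExistsForall (ex σ i φ)

/-- `L_{val,×}`-structures. -/
structure Str where
  carrier : Srt → Type
  zeroK : carrier .K
  oneK : carrier .K
  addK : carrier .K → carrier .K → carrier .K
  mulK : carrier .K → carrier .K → carrier .K
  zeroΓ : carrier .Γ
  inftyΓ : carrier .Γ
  addΓ : carrier .Γ → carrier .Γ → carrier .Γ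
  ltΓ : carrier .Γ → carrier .Γ → Prop
  zerok : carrier .k
  onek : carrier .k
  addk : carrier .k → carrier .k → carrier .k
  mulk : carrier .k → carrier .k → carrier .k
  v : carrier .K → carrier .Γ
  res : carrier .K → carrier .k
  s : carrier .Γ → carrier .K

/-- Assignments of values to the variables. -/
abbrev Str.Assignment (M : Str) : Type := (x : Srt × ℕ) → M.carrier x.1

def Term.eval (M : Str) (a : M.Assignment) : {σ : Srt} → Term σ → M.carrier σ
  | _, var σ i => a (σ, i)
  | _, zeroK => M.zeroK
  | _, oneK => M.oneK
  | _, addK x y => M.addK (x.eval M a) (y.eval M a)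
  | _, mulK x y => M.mulK (x.eval M a) (y.eval M a)
  | _, zeroΓ => M.zeroΓ
  | _, inftyΓ => M.inftyΓ
  | _, addΓ x y => M.addΓ (x.eval M a) (y.eval M a)
  | _, zerok => M.zerok
  | _, onek => M.onek
  | _, addk x y => M.addk (x.eval M a) (y.eval M a)
  | _, mulk x y => M.mulk (x.eval M a) (y.eval M a)
  | _, v x => M.v (x.eval M a)
  | _, res x => M.res (x.eval M a)
  | _, s x => M.s (x.eval M a)

open Classical in
/-- Tarski's satisfaction relation. -/
def Formula.Realize (M : Str) : Formula → M.Assignment → Prop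
  | falsum, _ => False
  | eq x y, a => x.eval M a = y.eval M a
  | lt x y, a => M.ltΓ (x.eval M a) (y.eval M a)
  | imp φ ψ, a => φ.Realize M a → ψ.Realize M a
  | all σ i φ, a => ∀ m : M.carrier σ, φ.Realize M (Function.update a (σ, i) m)
  | ex σ i φ, a => ∃ m : M.carrier σ, φ.Realize M (Function.update a (σ, i) m)

/-- Truth of a sentence in a structure (for a sentence and a structure with non-empty sorts, the
choice of the assignment does not matter). -/
def Str.Models (M : Str) (φ : Formula) : Prop := ∀ a : M.Assignment, φ.Realize M a

/-! Gödel numbering of `L_{val,×}`. -/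

def Srt.code : Srt → ℕ
  | K => 0
  | Γ => 1
  | k => 2

def Term.code : {σ : Srt} → Term σ → ℕ
  | _, var σ i => Nat.pair 0 (Nat.pair σ.code i)
  | _, zeroK => Nat.pair 1 0
  | _, oneK => Nat.pair 2 0
  | _, addK x y => Nat.pair 3 (Nat.pair x.code y.code)
  | _, mulK x y => Nat.pair 4 (Nat.pair x.code y.code)
  | _, zeroΓ => Nat.pair 5 0
  | _, inftyΓ => Nat.pair 6 0
  | _, addΓ x y => Nat.pair 7 (Nat.pair x.code y.code)
  | _, zerok => Nat.pair 8 0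
  | _, onek => Nat.pair 9 0
  | _, addk x y => Nat.pair 10 (Nat.pair x.code y.code)
  | _, mulk x y => Nat.pair 11 (Nat.pair x.code y.code)
  | _, v x => Nat.pair 12 x.code
  | _, res x => Nat.pair 13 x.code
  | _, s x => Nat.pair 14 x.code

def Formula.code : Formula → ℕ
  | falsum => Nat.pair 0 0
  | eq x y => Nat.pair 1 (Nat.pair x.code y.code)
  | lt x y => Nat.pair 2 (Nat.pair x.code y.code)
  | imp φ ψ => Nat.pair 3 (Nat.pair φ.code ψ.code)
  | all σ i φ => Nat.pair 4 (Nat.pair (Nat.pair σ.code i) φ.code)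
  | ex σ i φ => Nat.pair 5 (Nat.pair (Nat.pair σ.code i) φ.code)

theorem Term.code_inj : ∀ {σ : Lval.Srt} (x y : Lval.Term σ), x.code = y.code → x = y := by
  intro σ x
  induction x <;> intro y h <;> cases y <;> simp_all [Lval.Term.code, Nat.pair_eq_pair] <;>
    grind

theorem Term.code_sort : ∀ {σ τ : Lval.Srt} (x : Lval.Term σ) (y : Lval.Term τ), x.code = y.code → σ = τ := by
  intro σ τ x y h
  cases x <;> cases y <;> simp_all [Lval.Term.code, Nat.pair_eq_pair]
  rename_i i j
  cases σ <;> cases τ <;> simp_all [Lval.Srt.code]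

theorem Formula.code_inj : Function.Injective Lval.Formula.code := by
  intro x
  induction x <;> intro y h <;> cases y <;> simp_all [Lval.Formula.code, Nat.pair_eq_pair]
  case eq.eq a b σ c d =>
    obtain rfl := Lval.Term.code_sort _ _ h.1
    simp [Lval.Term.code_inj _ _ h.1, Lval.Term.code_inj _ _ h.2]
  case lt.lt => exact ⟨Lval.Term.code_inj _ _ h.1, Lval.Term.code_inj _ _ h.2⟩
  case imp.imp => grind
  case all.all σ _ _ _ τ _ _ => cases σ <;> cases τ <;> simp_all [Lval.Srt.code] <;> grind
  case ex.ex σ _ _ _ τ _ _ => cases σ <;> cases τ <;> simp_all [Lval.Srt.code] <;> grind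

end Lval

/-! ## Finite extensions of `ℚ_p` inside a fixed algebraic closure -/

namespace PadicExt

variable {p : ℕ} [Fact p.Prime]

/-- The additive valuation of a nonzero element of the algebraic closure of `ℚ_p`: the unique
extension of the `p`-adic valuation, with `ord p = 1`. -/
noncomputable def ord (x : PadicAlgCl p) : ℝ := -Real.logb p ‖x‖

/-- The value group `v(Kˣ)` of `K`. -/
noncomputable def valueGroup (K : IntermediateField ℚ_[p] (PadicAlgCl p)) : AddSubgroup ℝ where
  carrier := {r | ∃ x : K, x ≠ 0 ∧ ord (x : PadicAlgCl p) = r}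
  zero_mem' := ⟨1, one_ne_zero, by simp [ord]⟩
  add_mem' := by
    rintro _ _ ⟨x, hx, rfl⟩ ⟨y, hy, rfl⟩
    refine ⟨x * y, mul_ne_zero hx hy, ?_⟩
    have hx' : ‖(x : PadicAlgCl p)‖ ≠ 0 := by simpa using hx
    have hy' : ‖(y : PadicAlgCl p)‖ ≠ 0 := by simpa using hy
    simp only [ord, MulMemClass.coe_mul, norm_mul, Real.logb_mul hx' hy']
    ring
  neg_mem' := by
    rintro _ ⟨x, hx, rfl⟩
    exact ⟨x⁻¹, inv_ne_zero hx, by simp [ord, Real.logb_inv]⟩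

/-- The ramification index `e(K/ℚ_p) = (v(Kˣ) : v(ℚ_pˣ))`. -/
noncomputable def ramificationIndex (K : IntermediateField ℚ_[p] (PadicAlgCl p)) : ℕ :=
  (valueGroup (⊥ : IntermediateField ℚ_[p] (PadicAlgCl p))).relIndex (valueGroup K)

/-- `[K : ℚ_p] = e(K/ℚ_p) < ∞`. -/
def IsTotallyRamified (K : IntermediateField ℚ_[p] (PadicAlgCl p)) : Prop :=
  FiniteDimensional ℚ_[p] K ∧ Module.finrank ℚ_[p] K = ramificationIndex K

/-- The valuation ring `𝒪_K = {x ∈ K : ‖x‖ ≤ 1}`. -/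
noncomputable def integerRing (K : IntermediateField ℚ_[p] (PadicAlgCl p)) : ValuationSubring K :=
  ((PadicAlgCl.valued p).v.comap (algebraMap K (PadicAlgCl p))).valuationSubring

/-- The residue field of `𝒪_K`. -/
abbrev ResField (K : IntermediateField ℚ_[p] (PadicAlgCl p)) : Type :=
  IsLocalRing.ResidueField (integerRing K)

open Classical in
/-- The valuation `v : K → Γ ∪ {∞}`. -/
noncomputable def val (K : IntermediateField ℚ_[p] (PadicAlgCl p)) (x : K) :
    WithTop (valueGroup K) :=
  if h : x = 0 then ⊤ else ((⟨ord (x : PadicAlgCl p), x, h, rfl⟩ : valueGroup K) : WithTop _)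

open Classical in
/-- The residue map, extended by `0` outside `𝒪_K`. -/
noncomputable def resMap (K : IntermediateField ℚ_[p] (PadicAlgCl p)) (x : K) : ResField K :=
  if h : x ∈ integerRing K then IsLocalRing.residue (integerRing K) ⟨x, h⟩ else 0

/-- A cross-section of `K`: a group homomorphism `s : Γ → Kˣ` with `v ∘ s = id`. -/
structure CrossSection (K : IntermediateField ℚ_[p] (PadicAlgCl p)) where
  toHom : Multiplicative (valueGroup K) →* Kˣ
  val_toHom : ∀ γ : valueGroup K, val K (toHom (Multiplicative.ofAdd γ) : K) = γ

/-- The cross-section extended by `s(∞) = 0`. -/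
noncomputable def CrossSection.ext {K : IntermediateField ℚ_[p] (PadicAlgCl p)}
    (s : CrossSection K) : WithTop (valueGroup K) → K
  | ⊤ => 0
  | (γ : valueGroup K) => (s.toHom (Multiplicative.ofAdd γ) : K)

/-- `K` with its cross-section `s`, as an `L_{val,×}`-structure. -/
noncomputable def padicStr (K : IntermediateField ℚ_[p] (PadicAlgCl p)) (s : CrossSection K) :
    Lval.Str where
  carrier := fun
    | .K => K
    | .Γ => WithTop (valueGroup K)
    | .k => ResField K
  zeroK := (0 : K)
  oneK := (1 : K)
  addK := fun x y : K => x + y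
  mulK := fun x y : K => x * y
  zeroΓ := (0 : WithTop (valueGroup K))
  inftyΓ := (⊤ : WithTop (valueGroup K))
  addΓ := fun x y : WithTop (valueGroup K) => x + y
  ltΓ := fun x y : WithTop (valueGroup K) => x < y
  zerok := (0 : ResField K)
  onek := (1 : ResField K)
  addk := fun x y : ResField K => x + y
  mulk := fun x y : ResField K => x * y
  v := val K
  res := resMap K
  s := s.ext

/-- The totally ramified finite extensions of `ℚ_p`. -/
abbrev TotRam (p : ℕ) [Fact p.Prime] : Type :=
  {K : IntermediateField ℚ_[p] (PadicAlgCl p) // IsTotallyRamified K}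

/-- The asymptotic `∃∀`-theory of the totally ramified finite extensions `K` of `ℚ_p`, each
equipped with the cross-section `s K`: the `∃∀`-sentences that are true in all but finitely
many of them. -/
def asymptoticExistsForallTheory (s : (K : TotRam p) → CrossSection K.1) : Set Lval.Formula :=
  {φ | φ.IsSentence ∧ φ.IsExistsForall ∧
    ∀ᶠ K : TotRam p in Filter.cofinite, (padicStr K.1 (s K)).Models φ}

end PadicExt

/-- The characteristic function of a set of natural numbers, as an oracle. -/
noncomputable def charFun (A : Set ℕ) : ℕ →. ℕ := ((A.indicator 1 : ℕ → ℕ) : ℕ →. ℕ)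

/-!
Let `K / ℚ_p` be totally ramified of degree `n`, with uniformizer `π`. Sending `t` to `π` induces
an isomorphism `𝔽_p[t]/(t^n) ≅ 𝒪_K / p`. If `γ` is the least positive value, then `s(γ)` is a
uniformizer, so the isomorphism makes `P` definable: an integral `y` reduces into `P` if and only if
`y ≡ s(v(y))` modulo `p`. An existential sentence about `𝔽_p[t]/(t^n)` thus becomes an
`∃∀`-sentence about `K`, the universal quantifier serving only to single out `γ`. Every degree
`n ≥ 1` occurs, and by Krasner's lemma and compactness only finitely many `K` have a given degree,
so "for all but finitely many `n`" and "for all but finitely many `K`" match. The translation is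
primitive recursive on codes.
-/

theorem exists_pos_forall_le_dist {X : Type*} [MetricSpace X] {s : Set X} (hs : s.Finite) :
    ∃ δ > 0, ∀ x ∈ s, ∀ y ∈ s, x ≠ y → δ ≤ dist x y := by
  obtain ⟨C, hC, hsep⟩ := Set.einfsep_pos.1 hs.einfsep_pos
  have hfin : min C 1 ≠ ⊤ := (min_le_right C 1).trans_lt ENNReal.one_lt_top |>.ne
  refine ⟨(min C 1).toReal, ENNReal.toReal_pos (by simpa using hC.ne') hfin,
    fun x hx y hy hne => ?_⟩
  rw [dist_edist]
  exact ENNReal.toReal_mono (edist_ne_top x y) ((min_le_left C 1).trans (hsep x hx y hy hne))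

section Ultrametric

variable {E : Type*} [SeminormedAddCommGroup E] [IsUltrametricDist E] {x y : E} {r : ℝ}

theorem norm_sub_le_iff_of_norm_le (hy : ‖y‖ ≤ r) : ‖x - y‖ ≤ r ↔ ‖x‖ ≤ r := by
  refine ⟨fun h => ?_, fun h => ?_⟩
  · rw [← sub_add_cancel x y]
    exact (IsUltrametricDist.norm_add_le_max _ _).trans (max_le h hy)
  · rw [sub_eq_add_neg]
    exact (IsUltrametricDist.norm_add_le_max _ _).trans (max_le h ((norm_neg y).trans_le hy))

theorem norm_eq_of_norm_sub_lt_right (h : ‖x - y‖ < ‖y‖) : ‖x‖ = ‖y‖ := by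
  rw [← norm_neg y]
  refine IsUltrametricDist.norm_eq_of_add_norm_lt_max (lt_max_of_lt_right ?_)
  rwa [← sub_eq_add_neg, norm_neg]

end Ultrametric

theorem relIndex_zmultiples_nsmul {A : Type*} [AddGroup A] {a : A}
    (ha : ¬IsOfFinAddOrder a) (n : ℕ) :
    (AddSubgroup.zmultiples (n • a)).relIndex (AddSubgroup.zmultiples a) = n := by
  have hinj : Function.Injective (zmultiplesHom A a) := injective_zsmul_iff_not_isOfFinAddOrder.2 ha
  have hn : AddSubgroup.zmultiples (n • a) =
      (AddSubgroup.zmultiples (n : ℤ)).map (zmultiplesHom A a) := by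
    simp [AddMonoidHom.map_zmultiples]
  have hone : AddSubgroup.zmultiples a = (⊤ : AddSubgroup ℤ).map (zmultiplesHom A a) := by
    simp [← Int.zmultiples_one, AddMonoidHom.map_zmultiples]
  rw [hn, hone, AddSubgroup.relIndex_map_map_of_injective _ _ hinj, AddSubgroup.relIndex_top_right,
    Int.index_zmultiples, Int.natAbs_natCast]

namespace TruncPoly

variable {p n : ℕ}

theorem t_pow_eq_zero {k : ℕ} (h : n ≤ k) : t p n ^ k = 0 := by
  rw [t, ← map_pow, Ideal.Quotient.eq_zero_iff_mem, Ideal.mem_span_singleton]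
  exact pow_dvd_pow _ h

end TruncPoly

namespace PadicExt

open Polynomial IntermediateField

variable {p : ℕ} [Fact p.Prime]

/-! ## The additive valuation and value groups -/

theorem one_lt_cast_prime : (1 : ℝ) < p := by exact_mod_cast (Fact.out : p.Prime).one_lt

theorem ord_pow (x : PadicAlgCl p) (k : ℕ) : ord (x ^ k) = k * ord x := by
  simp [ord, Real.logb_pow]

theorem ord_eq_iff {x : PadicAlgCl p} (hx : x ≠ 0) {r : ℝ} :
    ord x = r ↔ ‖x‖ = (p : ℝ) ^ (-r) := by
  have hp := one_lt_cast_prime (p := p)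
  rw [ord, neg_eq_iff_eq_neg, Real.logb_eq_iff_rpow_eq (by linarith) hp.ne' (norm_pos_iff.2 hx),
    eq_comm]

theorem ord_le_ord_iff {x y : PadicAlgCl p} (hx : x ≠ 0) (hy : y ≠ 0) :
    ord y ≤ ord x ↔ ‖x‖ ≤ ‖y‖ := by
  rw [ord, ord, neg_le_neg_iff,
    Real.logb_le_logb one_lt_cast_prime (norm_pos_iff.2 hx) (norm_pos_iff.2 hy)]

theorem ord_algebraMap {a : ℚ_[p]} (ha : a ≠ 0) :
    ord (algebraMap ℚ_[p] (PadicAlgCl p) a) = a.valuation := by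
  rw [ord_eq_iff (by simpa using ha), PadicAlgCl.norm_extends, Padic.norm_eq_zpow_neg_valuation ha,
    ← Real.rpow_intCast, Int.cast_neg]

theorem norm_pow_natDegree_minpoly (x : PadicAlgCl p) :
    ‖x‖ ^ (minpoly ℚ_[p] x).natDegree = ‖(minpoly ℚ_[p] x).coeff 0‖ := by
  have hdeg : (minpoly ℚ_[p] x).natDegree ≠ 0 :=
    (minpoly.natDegree_pos (Algebra.IsIntegral.isIntegral x)).ne'
  rw [← PadicAlgCl.spectralNorm_eq, spectralNorm.spectralNorm_eq_norm_coeff_zero_rpow, one_div,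
    Real.rpow_inv_natCast_pow (norm_nonneg _) hdeg]

theorem natDegree_minpoly_dvd_finrank (K : IntermediateField ℚ_[p] (PadicAlgCl p))
    [FiniteDimensional ℚ_[p] K] {x : PadicAlgCl p} (hx : x ∈ K) :
    (minpoly ℚ_[p] x).natDegree ∣ Module.finrank ℚ_[p] K := by
  rw [← IntermediateField.minpoly_eq (⟨x, hx⟩ : K)]
  exact minpoly.degree_dvd (Algebra.IsIntegral.isIntegral _)

theorem exists_int_finrank_mul_ord (K : IntermediateField ℚ_[p] (PadicAlgCl p))
    [FiniteDimensional ℚ_[p] K] {x : PadicAlgCl p} (hxK : x ∈ K) (hx : x ≠ 0) :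
    ∃ z : ℤ, Module.finrank ℚ_[p] K * ord x = z := by
  have h0 : (minpoly ℚ_[p] x).coeff 0 ≠ 0 := fun h =>
    hx ((minpoly.coeff_zero_eq_zero (Algebra.IsIntegral.isIntegral x)).1 h)
  have hdeg : (minpoly ℚ_[p] x).natDegree * ord x = ((minpoly ℚ_[p] x).coeff 0).valuation := by
    rw [← ord_pow, ← ord_algebraMap h0, ord, ord, norm_pow, norm_pow_natDegree_minpoly,
      PadicAlgCl.norm_extends]
  obtain ⟨e, he⟩ := natDegree_minpoly_dvd_finrank K hxK
  refine ⟨e * ((minpoly ℚ_[p] x).coeff 0).valuation, ?_⟩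
  rw [he]
  push_cast
  rw [← hdeg]
  ring

theorem valueGroup_bot :
    valueGroup (⊥ : IntermediateField ℚ_[p] (PadicAlgCl p)) = AddSubgroup.zmultiples (1 : ℝ) := by
  ext r
  constructor
  · rintro ⟨⟨x, hx⟩, hx0, rfl⟩
    obtain ⟨a, rfl⟩ := IntermediateField.mem_bot.1 hx
    have ha : a ≠ 0 := by rintro rfl; exact hx0 (Subtype.ext (map_zero _))
    exact ⟨a.valuation, by simp [ord_algebraMap ha]⟩
  · rintro ⟨z, rfl⟩
    have hp : (p : ℚ_[p]) ^ z ≠ 0 :=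
      zpow_ne_zero _ (by exact_mod_cast (Fact.out : p.Prime).ne_zero)
    refine ⟨algebraMap _ _ ((p : ℚ_[p]) ^ z), _root_.map_ne_zero _ |>.2 hp, ?_⟩
    exact (ord_algebraMap hp).trans (by simp)

theorem valueGroup_mono : Monotone (valueGroup (p := p)) := by
  rintro K L hKL r ⟨x, hx, rfl⟩
  exact ⟨⟨x, hKL x.2⟩, fun h => hx (Subtype.ext (congrArg Subtype.val h :)), rfl⟩

theorem valueGroup_le (K : IntermediateField ℚ_[p] (PadicAlgCl p)) [FiniteDimensional ℚ_[p] K] :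
    valueGroup K ≤ AddSubgroup.zmultiples (Module.finrank ℚ_[p] K : ℝ)⁻¹ := by
  rintro r ⟨x, hx, rfl⟩
  obtain ⟨z, hz⟩ := exists_int_finrank_mul_ord K x.2 (by simpa using hx)
  have hn : (Module.finrank ℚ_[p] K : ℝ) ≠ 0 := by exact_mod_cast Module.finrank_pos.ne'
  refine ⟨z, ?_⟩
  simp only [zsmul_eq_mul, ← hz]
  field_simp

theorem relIndex_valueGroup_bot {n : ℕ} (hn : n ≠ 0) :
    (valueGroup (⊥ : IntermediateField ℚ_[p] (PadicAlgCl p))).relIndex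
      (AddSubgroup.zmultiples (n : ℝ)⁻¹) = n := by
  have hn' : (n : ℝ) ≠ 0 := by exact_mod_cast hn
  have h := relIndex_zmultiples_nsmul
    (not_isOfFinAddOrder_of_isAddTorsionFree (inv_ne_zero hn')) n
  rwa [nsmul_eq_mul, mul_inv_cancel₀ hn', ← valueGroup_bot (p := p)] at h

theorem isTotallyRamified_iff_valueGroup_eq {K : IntermediateField ℚ_[p] (PadicAlgCl p)}
    [FiniteDimensional ℚ_[p] K] : IsTotallyRamified K ↔
      valueGroup K = AddSubgroup.zmultiples (Module.finrank ℚ_[p] K : ℝ)⁻¹ := by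
  have hn : Module.finrank ℚ_[p] K ≠ 0 := Module.finrank_pos.ne'
  refine ⟨fun hK => le_antisymm (valueGroup_le K) (AddSubgroup.relIndex_eq_one.1 ?_), fun h => ?_⟩
  · have hmul := AddSubgroup.relIndex_mul_relIndex _ _ _ (valueGroup_mono bot_le) (valueGroup_le K)
    rw [← ramificationIndex, ← hK.2, relIndex_valueGroup_bot hn] at hmul
    exact (mul_eq_left₀ hn).1 hmul
  · exact ⟨inferInstance, by rw [ramificationIndex, h, relIndex_valueGroup_bot hn]⟩

/-! ## Uniformizers -/

/-- `π` has the absolute value of a uniformizer of a totally ramified extension of `ℚ_p` of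
degree `n`; there is no such `π` for `n = 0`. -/
def IsUniformizer (n : ℕ) (π : PadicAlgCl p) : Prop := ‖π‖ ^ n = (p : ℝ)⁻¹

theorem inv_cast_prime_lt_one : (p : ℝ)⁻¹ < 1 := inv_lt_one_of_one_lt₀ one_lt_cast_prime

theorem inv_cast_prime_pos : 0 < (p : ℝ)⁻¹ := inv_pos.2 (one_pos.trans one_lt_cast_prime)

namespace IsUniformizer

variable {n : ℕ} {π : PadicAlgCl p}

theorem index_ne_zero (hπ : IsUniformizer n π) : n ≠ 0 := by
  rintro rfl
  rw [IsUniformizer, pow_zero] at hπ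
  exact inv_cast_prime_lt_one.ne' hπ

theorem ne_zero (hπ : IsUniformizer n π) : π ≠ 0 := by
  have hn := hπ.index_ne_zero
  rintro rfl
  rw [IsUniformizer, norm_zero, zero_pow hn] at hπ
  exact inv_cast_prime_pos.ne hπ

theorem norm_pos (hπ : IsUniformizer n π) : 0 < ‖π‖ := norm_pos_iff.2 hπ.ne_zero

theorem norm_lt_one (hπ : IsUniformizer n π) : ‖π‖ < 1 := by
  rw [← pow_lt_one_iff_of_nonneg (norm_nonneg _) hπ.index_ne_zero, hπ]
  exact inv_cast_prime_lt_one

theorem inv_le_norm (hπ : IsUniformizer n π) : (p : ℝ)⁻¹ ≤ ‖π‖ :=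
  hπ.ge.trans (pow_le_of_le_one (norm_nonneg _) hπ.norm_lt_one.le hπ.index_ne_zero)

end IsUniformizer

theorem isUniformizer_iff_ord_eq {n : ℕ} (hn : n ≠ 0) {π : PadicAlgCl p} (hπ : π ≠ 0) :
    IsUniformizer n π ↔ ord π = (n : ℝ)⁻¹ := by
  have hn' : (n : ℝ) ≠ 0 := by exact_mod_cast hn
  rw [IsUniformizer, ← norm_pow, ← Real.rpow_neg_one, ← ord_eq_iff (pow_ne_zero n hπ), ord_pow,
    mul_comm, mul_eq_one_iff_eq_inv₀ hn']

section Field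

variable {K : IntermediateField ℚ_[p] (PadicAlgCl p)} {n : ℕ} {π : PadicAlgCl p}

theorem IsUniformizer.dvd_finrank [FiniteDimensional ℚ_[p] K] (hπ : IsUniformizer n π)
    (hπK : π ∈ K) : n ∣ Module.finrank ℚ_[p] K := by
  have hn : (n : ℝ) ≠ 0 := by exact_mod_cast hπ.index_ne_zero
  obtain ⟨z, hz⟩ := exists_int_finrank_mul_ord K hπK hπ.ne_zero
  rw [(isUniformizer_iff_ord_eq hπ.index_ne_zero hπ.ne_zero).1 hπ, mul_inv_eq_iff_eq_mul₀ hn] at hz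
  refine Int.natCast_dvd_natCast.1 ⟨z, ?_⟩
  rw [mul_comm]
  exact_mod_cast hz

theorem finiteDimensional_adjoin (x : PadicAlgCl p) : FiniteDimensional ℚ_[p] ℚ_[p]⟮x⟯ :=
  adjoin.finiteDimensional (Algebra.IsIntegral.isIntegral x)

theorem IsUniformizer.adjoin_eq (hπ : IsUniformizer n π) (hπK : π ∈ K)
    (hK : Module.finrank ℚ_[p] K = n) : ℚ_[p]⟮π⟯ = K := by
  have := FiniteDimensional.of_finrank_pos (hK ▸ Nat.pos_of_ne_zero hπ.index_ne_zero)
  have := finiteDimensional_adjoin π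
  refine eq_of_le_of_finrank_le (adjoin_simple_le_iff.2 hπK) (hK.trans_le ?_)
  exact Nat.le_of_dvd Module.finrank_pos (hπ.dvd_finrank (mem_adjoin_simple_self _ π))

theorem IsUniformizer.isTotallyRamified (hπ : IsUniformizer n π) (hπK : π ∈ K)
    (hK : Module.finrank ℚ_[p] K = n) : IsTotallyRamified K := by
  have := FiniteDimensional.of_finrank_pos (hK ▸ Nat.pos_of_ne_zero hπ.index_ne_zero)
  refine isTotallyRamified_iff_valueGroup_eq.2 (le_antisymm (valueGroup_le K) ?_)
  rw [AddSubgroup.zmultiples_le, hK]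
  exact ⟨⟨π, hπK⟩, fun h => hπ.ne_zero (congrArg Subtype.val h),
    (isUniformizer_iff_ord_eq hπ.index_ne_zero hπ.ne_zero).1 hπ⟩

theorem IsTotallyRamified.exists_isUniformizer (hK : IsTotallyRamified K) :
    ∃ π ∈ K, IsUniformizer (Module.finrank ℚ_[p] K) π := by
  have := hK.1
  obtain ⟨π, hπ, hord⟩ : (Module.finrank ℚ_[p] K : ℝ)⁻¹ ∈ valueGroup K := by
    rw [isTotallyRamified_iff_valueGroup_eq.1 hK]
    exact AddSubgroup.mem_zmultiples _
  exact ⟨π, π.2, (isUniformizer_iff_ord_eq Module.finrank_pos.ne' (by simpa using hπ)).2 hord⟩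

theorem IsUniformizer.finrank_adjoin_of_aeval_eq_zero (hπ : IsUniformizer n π) {f : ℚ_[p][X]}
    (hf : f.Monic) (hdeg : f.natDegree = n) (hroot : aeval π f = 0) :
    Module.finrank ℚ_[p] ℚ_[p]⟮π⟯ = n := by
  have := finiteDimensional_adjoin π
  refine le_antisymm ?_ (Nat.le_of_dvd Module.finrank_pos
    (hπ.dvd_finrank (mem_adjoin_simple_self _ π)))
  rw [adjoin.finrank (Algebra.IsIntegral.isIntegral π), ← hdeg]
  exact natDegree_le_natDegree (minpoly.min _ π hf hroot)

theorem exists_totRam_finrank_eq (hn : n ≠ 0) :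
    ∃ K : TotRam p, Module.finrank ℚ_[p] K.1 = n := by
  obtain ⟨π, hpow⟩ := IsAlgClosed.exists_pow_nat_eq (p : PadicAlgCl p) (Nat.pos_of_ne_zero hn)
  have hπ : IsUniformizer n π := by
    rw [IsUniformizer, ← norm_pow, hpow, ← map_natCast (algebraMap ℚ_[p] (PadicAlgCl p)),
      PadicAlgCl.norm_extends, Padic.norm_p]
  have hroot : aeval π (X ^ n - C (p : ℚ_[p])) = 0 := by simp [hpow]
  have hfin := hπ.finrank_adjoin_of_aeval_eq_zero (monic_X_pow_sub_C _ hn) natDegree_X_pow_sub_C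
    hroot
  exact ⟨⟨ℚ_[p]⟮π⟯, hπ.isTotallyRamified (mem_adjoin_simple_self ℚ_[p] π) hfin⟩, hfin⟩

end Field

/-! ## `𝒪_K / p ≅ 𝔽_p[t]/(t^n)` -/

namespace IsUniformizer

variable {n : ℕ} {π : PadicAlgCl p}

theorem norm_smul_pow_pow (hπ : IsUniformizer n π) {c : ℚ_[p]} (hc : c ≠ 0) (i : ℕ) :
    ‖c • π ^ i‖ ^ n = (p : ℝ) ^ (-(n * c.valuation + i)) := by
  have hp : (p : ℝ) ≠ 0 := (one_pos.trans one_lt_cast_prime).ne'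
  rw [norm_smul, norm_pow, mul_pow, pow_right_comm, hπ, Padic.norm_eq_zpow_neg_valuation hc,
    ← zpow_natCast, ← zpow_mul, ← zpow_natCast, inv_zpow', ← zpow_add₀ hp]
  ring_nf

theorem norm_smul_pow_injOn (hπ : IsUniformizer n π) {c d : ℚ_[p]} (hc : c ≠ 0) (hd : d ≠ 0)
    {i j : ℕ} (hi : i < n) (hj : j < n) (h : ‖c • π ^ i‖ = ‖d • π ^ j‖) : i = j := by
  have hexp := congrArg (· ^ n) h
  simp only [hπ.norm_smul_pow_pow hc, hπ.norm_smul_pow_pow hd] at hexp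
  have hval := neg_inj.1 (zpow_right_injective₀ (one_pos.trans one_lt_cast_prime)
    one_lt_cast_prime.ne' hexp)
  have hmod := congrArg (· % (n : ℤ)) hval
  simp only [Int.mul_add_emod_self_left] at hmod
  exact Nat.ModEq.eq_of_lt_of_lt (by exact_mod_cast hmod) hi hj

theorem norm_smul_pow_le_zpow_iff (hπ : IsUniformizer n π) {i : ℕ} (hi : i < n) (c : ℚ_[p])
    (m : ℤ) : ‖c • π ^ i‖ ≤ (p : ℝ) ^ m ↔ ‖c‖ ≤ (p : ℝ) ^ m := by
  have hp : (0 : ℝ) < p := one_pos.trans one_lt_cast_prime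
  rw [norm_smul, norm_pow]
  refine ⟨fun h => ?_, fun h => (mul_le_of_le_one_right (norm_nonneg _)
    (pow_le_one₀ (norm_nonneg _) hπ.norm_lt_one.le)).trans h⟩
  contrapose! h
  have hc : (p : ℝ) ^ (m + 1) ≤ ‖c‖ := by
    rwa [← not_lt, ← Padic.norm_le_pow_iff_norm_lt_pow_add_one, not_le]
  calc (p : ℝ) ^ m = p ^ (m + 1) * ‖π‖ ^ n := by
        rw [hπ, zpow_add_one₀ hp.ne', mul_inv_cancel_right₀ hp.ne']
    _ < p ^ (m + 1) * ‖π‖ ^ i := by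
        have hpow := pow_lt_pow_right_of_lt_one₀ hπ.norm_pos hπ.norm_lt_one hi
        exact mul_lt_mul_of_pos_left hpow (by positivity)
    _ ≤ ‖c‖ * ‖π‖ ^ i := by gcongr

/-- For `i < n` the nonzero `c_i π ^ i` have pairwise distinct absolute values, so the largest of
them is the absolute value of their sum. -/
theorem norm_aeval_le_zpow_iff (hπ : IsUniformizer n π) {f : ℚ_[p][X]} (hf : f.degree < n)
    (m : ℤ) : ‖aeval π f‖ ≤ (p : ℝ) ^ m ↔ ∀ i, ‖f.coeff i‖ ≤ (p : ℝ) ^ m := by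
  have hlt {i : ℕ} (hi : i ∈ f.support) : i < n :=
    WithBot.coe_lt_coe.1 ((le_degree_of_mem_supp i hi).trans_lt hf)
  have hsum : ‖aeval π f‖₊ = f.support.sup fun i => ‖f.coeff i • π ^ i‖₊ := by
    rw [aeval_def, eval₂_eq_sum, sum_def]
    simp only [← Algebra.smul_def]
    refine IsUltrametricDist.nnnorm_sum_eq_sup_of_pairwise_ne fun i hi j hj hij h => hij ?_
    exact hπ.norm_smul_pow_injOn (mem_support_iff.1 hi) (mem_support_iff.1 hj) (hlt hi) (hlt hj)
      (congrArg NNReal.toReal h)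
  have hp : (0 : ℝ) ≤ (p : ℝ) ^ m := by positivity
  lift (p : ℝ) ^ m to NNReal using hp with r hr
  rw [← coe_nnnorm, hsum, NNReal.coe_le_coe, Finset.sup_le_iff]
  refine ⟨fun h i => ?_, fun h i hi => ?_⟩
  · by_cases hi : i ∈ f.support
    · rw [hr, ← hπ.norm_smul_pow_le_zpow_iff (hlt hi), ← hr]
      exact h i hi
    · rw [notMem_support_iff.1 hi, norm_zero]
      exact r.2
  · rw [← NNReal.coe_le_coe, coe_nnnorm, hr, hπ.norm_smul_pow_le_zpow_iff (hlt hi), ← hr]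
    exact h i

end IsUniformizer

section Reduces

variable {n : ℕ} {π : PadicAlgCl p}

theorem toZMod_eq_zero_iff (x : ℤ_[p]) : PadicInt.toZMod x = 0 ↔ ‖x‖ ≤ (p : ℝ)⁻¹ := by
  rw [← RingHom.mem_ker, PadicInt.ker_toZMod, PadicInt.maximalIdeal_eq_span_p]
  simpa using (PadicInt.norm_le_pow_iff_mem_span_pow x 1).symm

namespace IsUniformizer

theorem norm_aeval_le_one (hπ : IsUniformizer n π) (g : ℤ_[p][X]) : ‖aeval π g‖ ≤ 1 := by
  rw [aeval_eq_sum_range]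
  refine IsUltrametricDist.norm_sum_le_of_forall_le_of_nonneg zero_le_one fun i _ => ?_
  rw [← algebraMap_smul ℚ_[p], norm_smul, norm_pow]
  exact mul_le_one₀ (PadicInt.norm_le_one _) (by positivity)
    (pow_le_one₀ (norm_nonneg _) hπ.norm_lt_one.le)

theorem norm_aeval_le_iff (hπ : IsUniformizer n π) (g : ℤ_[p][X]) :
    ‖aeval π g‖ ≤ (p : ℝ)⁻¹ ↔
      (Ideal.Quotient.mk _ (g.map PadicInt.toZMod) : TruncPoly p n) = 0 := by
  set r := g %ₘ X ^ n
  have hdiv : ‖aeval π (X ^ n * (g /ₘ X ^ n))‖ ≤ (p : ℝ)⁻¹ := by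
    rw [map_mul, map_pow, aeval_X, norm_mul, norm_pow, hπ]
    exact mul_le_of_le_one_right inv_cast_prime_pos.le (hπ.norm_aeval_le_one _)
  have hmod : ‖aeval π g‖ ≤ (p : ℝ)⁻¹ ↔ ‖aeval π r‖ ≤ (p : ℝ)⁻¹ := by
    rw [← norm_sub_le_iff_of_norm_le hdiv, ← map_sub, ← modByMonic_eq_sub_mul_div]
  have hdeg : (r.map (algebraMap ℤ_[p] ℚ_[p])).degree < n :=
    degree_map_le.trans_lt ((degree_modByMonic_lt g (monic_X_pow n)).trans_eq (degree_X_pow n))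
  rw [Ideal.Quotient.eq_zero_iff_mem, Ideal.mem_span_singleton,
    ← modByMonic_eq_zero_iff_dvd (monic_X_pow n), ← Polynomial.map_X PadicInt.toZMod,
    ← Polynomial.map_pow, ← map_modByMonic _ (monic_X_pow n), hmod,
    ← aeval_map_algebraMap ℚ_[p], ← zpow_neg_one, hπ.norm_aeval_le_zpow_iff hdeg,
    Polynomial.ext_iff]
  simp only [coeff_map, coeff_zero, toZMod_eq_zero_iff, zpow_neg_one]
  rfl

end IsUniformizer

/-- `y` is the reduction modulo `p` of `x ∈ ℤ_p[π]`, where `π` reduces to `t`. -/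
def Reduces (π x : PadicAlgCl p) (y : TruncPoly p n) : Prop :=
  ∃ g : ℤ_[p][X], aeval π g = x ∧ Ideal.Quotient.mk _ (g.map PadicInt.toZMod) = y

namespace Reduces

variable {x x' : PadicAlgCl p} {y y' : TruncPoly p n}

theorem zero : Reduces π 0 (0 : TruncPoly p n) := ⟨0, by simp⟩

theorem one : Reduces π 1 (1 : TruncPoly p n) := ⟨1, by simp⟩

theorem add (h : Reduces π x y) (h' : Reduces π x' y') : Reduces π (x + x') (y + y') := by
  obtain ⟨g, rfl, rfl⟩ := h
  obtain ⟨g', rfl, rfl⟩ := h'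
  exact ⟨g + g', by simp⟩

theorem mul (h : Reduces π x y) (h' : Reduces π x' y') : Reduces π (x * x') (y * y') := by
  obtain ⟨g, rfl, rfl⟩ := h
  obtain ⟨g', rfl, rfl⟩ := h'
  exact ⟨g * g', by simp⟩

theorem pow (h : Reduces π x y) (k : ℕ) : Reduces π (x ^ k) (y ^ k) := by
  obtain ⟨g, rfl, rfl⟩ := h
  exact ⟨g ^ k, by simp⟩

theorem uniformizer : Reduces π π (TruncPoly.t p n) := ⟨X, by simp [TruncPoly.t]⟩

theorem norm_le_one (hπ : IsUniformizer n π) (h : Reduces π x y) : ‖x‖ ≤ 1 := by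
  obtain ⟨g, rfl, -⟩ := h
  exact hπ.norm_aeval_le_one g

theorem norm_sub_le_iff (hπ : IsUniformizer n π) (h : Reduces π x y) (h' : Reduces π x' y') :
    ‖x - x'‖ ≤ (p : ℝ)⁻¹ ↔ y = y' := by
  obtain ⟨g, rfl, rfl⟩ := h
  obtain ⟨g', rfl, rfl⟩ := h'
  rw [← map_sub, hπ.norm_aeval_le_iff, Polynomial.map_sub, map_sub, sub_eq_zero]

end Reduces

section Field

variable {K : IntermediateField ℚ_[p] (PadicAlgCl p)}

theorem exists_reduces_left (hπK : π ∈ K) (y : TruncPoly p n) : ∃ x ∈ K, Reduces π x y := by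
  obtain ⟨f, rfl⟩ := Ideal.Quotient.mk_surjective y
  obtain ⟨g, rfl⟩ := map_surjective PadicInt.toZMod (ZMod.ringHom_surjective PadicInt.toZMod) f
  have hK : aeval π (g.map (algebraMap ℤ_[p] ℚ_[p])) ∈ K :=
    IntermediateField.aeval_coe K ⟨π, hπK⟩ (g.map (algebraMap ℤ_[p] ℚ_[p])) ▸ Subtype.coe_prop _
  exact ⟨aeval π g, aeval_map_algebraMap ℚ_[p] π g ▸ hK, g, rfl, rfl⟩

theorem IsUniformizer.exists_reduces_right (hπ : IsUniformizer n π) (hπK : π ∈ K)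
    (hK : Module.finrank ℚ_[p] K = n) {x : PadicAlgCl p} (hx : x ∈ K) (hx1 : ‖x‖ ≤ 1) :
    ∃ y : TruncPoly p n, Reduces π x y := by
  have hint : IsIntegral ℚ_[p] π := Algebra.IsIntegral.isIntegral π
  have hdeg : (minpoly ℚ_[p] π).natDegree = n := by
    rw [← adjoin.finrank hint, hπ.adjoin_eq hπK hK, hK]
  obtain ⟨f, rfl⟩ : ∃ f, aeval π f = x := by
    rwa [← hπ.adjoin_eq hπK hK, ← mem_toSubalgebra,
      adjoin_simple_toSubalgebra_of_isAlgebraic hint.isAlgebraic,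
      Algebra.adjoin_singleton_eq_range_aeval] at hx
  have hmod : (f %ₘ minpoly ℚ_[p] π).degree < n := by
    rw [← hdeg, ← degree_eq_natDegree (minpoly.ne_zero hint)]
    exact degree_modByMonic_lt f (minpoly.monic hint)
  rw [← aeval_modByMonic_eq_self_of_root (minpoly.aeval _ π), ← zpow_zero (p : ℝ),
    hπ.norm_aeval_le_zpow_iff hmod, zpow_zero] at hx1
  obtain ⟨g, hg⟩ : f %ₘ minpoly ℚ_[p] π ∈ lifts (algebraMap ℤ_[p] ℚ_[p]) :=
    (lifts_iff_coeff_lifts _).2 fun i => ⟨⟨_, hx1 i⟩, rfl⟩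
  refine ⟨_, g, ?_, rfl⟩
  rw [← aeval_map_algebraMap ℚ_[p], ← coe_mapRingHom, hg,
    aeval_modByMonic_eq_self_of_root (minpoly.aeval _ π)]

end Field

end Reduces

/-! ## Finiteness of the totally ramified extensions of given degree -/

section Finiteness

variable {n : ℕ}

theorem norm_coeff_minpoly_le_one {x : PadicAlgCl p} (hx : ‖x‖ ≤ 1) (i : ℕ) :
    ‖(minpoly ℚ_[p] x).coeff i‖ ≤ 1 :=
  (spectralValue_le_one_iff (minpoly.monic (Algebra.IsIntegral.isIntegral x))).1
    ((PadicAlgCl.spectralNorm_eq p x).trans_le hx) i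

theorem norm_coeff_sub_lt_of_dist_toFn_lt {f g : ℚ_[p][X]} (hf : f.Monic) (hg : g.Monic)
    (hdeg : f.natDegree = n) (hdeg' : g.natDegree = n) {ε : ℝ} (hε : 0 < ε)
    (h : dist (toFn n f) (toFn n g) < ε) (i : ℕ) : ‖f.coeff i - g.coeff i‖ < ε := by
  rcases lt_trichotomy i n with hi | rfl | hi
  · exact dist_eq_norm (f.coeff i) _ ▸ (dist_pi_lt_iff hε).1 h ⟨i, hi⟩
  · rwa [← hdeg', hg.coeff_natDegree, hdeg', ← hdeg, hf.coeff_natDegree, sub_self, norm_zero]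
  · rwa [coeff_eq_zero_of_natDegree_lt (hdeg ▸ hi), coeff_eq_zero_of_natDegree_lt (hdeg' ▸ hi),
      sub_self, norm_zero]

/-- Krasner's lemma: if `g` is close enough to `f`, its roots are closer to roots of `f` than these
are to each other. -/
theorem exists_pos_forall_adjoin_eq (hn : n ≠ 0) {f : ℚ_[p][X]} (hf : f.Monic)
    (hdeg : f.natDegree = n) : ∃ ε > 0, ∀ g : ℚ_[p][X], g.Monic → g.natDegree = n →
      dist (toFn n f) (toFn n g) < ε → ∀ π : PadicAlgCl p, IsUniformizer n π → aeval π g = 0 →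
        ∃ β ∈ f.rootSet (PadicAlgCl p), ℚ_[p]⟮β⟯ = ℚ_[p]⟮π⟯ := by
  obtain ⟨δ, hδ, hsep⟩ := exists_pos_forall_le_dist (f.rootSet_finite (PadicAlgCl p))
  set r := min δ (p : ℝ)⁻¹
  have hr : 0 < r := lt_min hδ inv_cast_prime_pos
  refine ⟨r ^ n / (n + 1), by positivity, fun g hg hgdeg hdist π hπ hroot => ?_⟩
  obtain ⟨β, hβ, hclose⟩ := exists_aroots_norm_sub_lt_of_norm_coeff_sub_lt (by positivity) hroot hg
    hf (hdeg.trans hgdeg.symm)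
    (norm_coeff_sub_lt_of_dist_toFn_lt hf hg hdeg hgdeg (by positivity) hdist)
    (IsAlgClosed.splits _)
  rw [hgdeg, mul_div_cancel₀ _ (by positivity), Real.pow_rpow_inv_natCast hr.le hn,
    max_eq_right hπ.norm_lt_one.le, mul_one] at hclose
  have hβf : β ∈ f.rootSet (PadicAlgCl p) := by simpa [rootSet] using hβ
  have hβπ : IsUniformizer n β := by
    have hnorm : ‖β‖ = ‖π‖ := norm_eq_of_norm_sub_lt_right <|
      (norm_sub_rev β π).trans_lt (hclose.trans_le ((min_le_right _ _).trans hπ.inv_le_norm))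
    rwa [IsUniformizer, hnorm]
  refine ⟨β, hβf, hβπ.adjoin_eq ?_ (hπ.finrank_adjoin_of_aeval_eq_zero hg hgdeg hroot)⟩
  refine IsKrasner.krasner (Algebra.IsSeparable.isSeparable _ β) (IsAlgClosed.splits _)
    (Algebra.IsIntegral.isIntegral π) fun x hx hne => ?_
  have hxf : x ∈ f.rootSet (PadicAlgCl p) :=
    mem_rootSet.2 ⟨hf.ne_zero, aeval_eq_zero_of_dvd_aeval_eq_zero
      (minpoly.dvd _ β (aeval_eq_zero_of_mem_rootSet hβf)) hx.aeval_eq_zero⟩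
  rw [norm_sub_rev, ← dist_eq_norm β x]
  exact hclose.trans_le ((min_le_left _ _).trans (hsep β hβf x hxf hne))

/-- The fields generated by those uniformizers that are roots of a monic polynomial of degree `n`
whose vector of lower coefficients lies in `s`. -/
def uniformizerFields (s : Set (Fin n → ℚ_[p])) :
    Set (IntermediateField ℚ_[p] (PadicAlgCl p)) :=
  {K | ∃ f : ℚ_[p][X], f.Monic ∧ f.natDegree = n ∧ toFn n f ∈ s ∧
    ∃ π : PadicAlgCl p, IsUniformizer n π ∧ aeval π f = 0 ∧ ℚ_[p]⟮π⟯ = K}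

theorem exists_nhds_finite_uniformizerFields (hn : n ≠ 0) (c : Fin n → ℚ_[p]) :
    ∃ U ∈ nhds c, (uniformizerFields U).Finite := by
  classical
  have hmonic : (X ^ n + ofFn n c).Monic := monic_X_pow_add (ofFn_degree_lt c)
  have hdeg : (X ^ n + ofFn n c).natDegree = n := by
    rw [natDegree_add_eq_left_of_degree_lt ((ofFn_degree_lt c).trans_eq (degree_X_pow n).symm),
      natDegree_X_pow]
  have hc : toFn n (X ^ n + ofFn n c) = c := by
    rw [map_add, toFn_comp_ofFn_eq_id]
    ext i
    simp [toFn, coeff_X_pow, i.2.ne]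
  obtain ⟨ε, hε, h⟩ := exists_pos_forall_adjoin_eq hn hmonic hdeg
  refine ⟨Metric.ball c ε, Metric.ball_mem_nhds c hε,
    (((X ^ n + ofFn n c).rootSet_finite (PadicAlgCl p)).image fun β => ℚ_[p]⟮β⟯).subset ?_⟩
  rintro _ ⟨g, hg, hgdeg, hgc, π, hπ, hroot, rfl⟩
  exact h g hg hgdeg (by rwa [hc, dist_comm]) π hπ hroot

theorem finite_uniformizerFields (hn : n ≠ 0) {s : Set (Fin n → ℚ_[p])} (hs : IsCompact s) :
    (uniformizerFields s).Finite := by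
  refine hs.induction_on (p := fun s => (uniformizerFields s).Finite) ?_ ?_ ?_ ?_
  · simp [uniformizerFields]
  · rintro s t hst ht
    refine ht.subset ?_
    rintro K ⟨f, hf, hdeg, hfs, hK⟩
    exact ⟨f, hf, hdeg, hst hfs, hK⟩
  · rintro s t hs ht
    refine (hs.union ht).subset ?_
    rintro K ⟨f, hf, hdeg, hfs | hft, hK⟩
    · exact Or.inl ⟨f, hf, hdeg, hfs, hK⟩
    · exact Or.inr ⟨f, hf, hdeg, hft, hK⟩
  · intro c _
    obtain ⟨U, hU, hfin⟩ := exists_nhds_finite_uniformizerFields hn c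
    exact ⟨U, mem_nhdsWithin_of_mem_nhds hU, hfin⟩

theorem IsTotallyRamified.mem_uniformizerFields {K : IntermediateField ℚ_[p] (PadicAlgCl p)}
    (hK : IsTotallyRamified K) :
    K ∈ uniformizerFields (Metric.closedBall (0 : Fin (Module.finrank ℚ_[p] K) → ℚ_[p]) 1) := by
  obtain ⟨π, hπK, hπ⟩ := hK.exists_isUniformizer
  have hadj := hπ.adjoin_eq hπK rfl
  have hint : IsIntegral ℚ_[p] π := Algebra.IsIntegral.isIntegral π
  refine ⟨minpoly ℚ_[p] π, minpoly.monic hint, by rw [← adjoin.finrank hint, hadj], ?_, π, hπ,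
    minpoly.aeval _ π, hadj⟩
  rw [mem_closedBall_zero_iff, pi_norm_le_iff_of_nonneg zero_le_one]
  exact fun i => norm_coeff_minpoly_le_one hπ.norm_lt_one.le i

theorem finite_totRam_finrank_eq (n : ℕ) :
    {K : TotRam p | Module.finrank ℚ_[p] K.1 = n}.Finite := by
  rcases eq_or_ne n 0 with rfl | hn
  · refine Set.finite_empty.subset fun K hK => ?_
    have := K.2.1
    exact Module.finrank_pos.ne' hK
  · refine .of_finite_image ((finite_uniformizerFields hn
      (isCompact_closedBall 0 1)).subset ?_) Subtype.val_injective.injOn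
    rintro _ ⟨K, rfl, rfl⟩
    exact K.2.mem_uniformizerFields

theorem eventually_totRam_finrank_iff {P : ℕ → Prop} :
    (∀ᶠ K : TotRam p in Filter.cofinite, P (Module.finrank ℚ_[p] K.1)) ↔
      ∀ᶠ n in Filter.cofinite, P n := by
  refine ⟨fun h => ?_, fun h => ?_⟩
  · refine ((h.image fun K : TotRam p => Module.finrank ℚ_[p] K.1).union
      (Set.finite_singleton 0)).subset fun n hn => ?_
    rw [Set.union_singleton, Set.mem_insert_iff]
    refine or_iff_not_imp_left.2 fun hn0 => ?_
    obtain ⟨K, rfl⟩ := exists_totRam_finrank_eq (p := p) hn0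
    exact ⟨K, hn, rfl⟩
  · exact Filter.Tendsto.cofinite_of_finite_preimage_singleton finite_totRam_finrank_eq h

end Finiteness

/-! ## Cross-sections of totally ramified extensions -/

variable {K : IntermediateField ℚ_[p] (PadicAlgCl p)}

theorem val_le_val_iff {x y : K} :
    val K x ≤ val K y ↔ ‖(y : PadicAlgCl p)‖ ≤ ‖(x : PadicAlgCl p)‖ := by
  by_cases hx : x = 0
  · simp [val, hx]
  by_cases hy : y = 0
  · simp [val, hy]
  rw [← ord_le_ord_iff (by simpa using hy) (by simpa using hx)]
  simp only [val, hx, hy, dif_neg, not_false_eq_true, WithTop.coe_le_coe]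
  rfl

theorem val_lt_val_iff {x y : K} :
    val K x < val K y ↔ ‖(y : PadicAlgCl p)‖ < ‖(x : PadicAlgCl p)‖ := by
  rw [← not_le, val_le_val_iff, not_le]

theorem val_eq_val_iff {x y : K} :
    val K x = val K y ↔ ‖(x : PadicAlgCl p)‖ = ‖(y : PadicAlgCl p)‖ := by
  rw [le_antisymm_iff, val_le_val_iff, val_le_val_iff, and_comm, ← le_antisymm_iff]

theorem val_one : val K 1 = 0 := by
  rw [val, dif_neg one_ne_zero, ← WithTop.coe_zero, WithTop.coe_inj]
  exact Subtype.ext (by simp [ord])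

theorem val_nonneg_iff {x : K} : 0 ≤ val K x ↔ ‖(x : PadicAlgCl p)‖ ≤ 1 := by
  rw [← val_one, val_le_val_iff, OneMemClass.coe_one, norm_one]

namespace CrossSection

variable (s : CrossSection K)

theorem val_ext (γ : WithTop (valueGroup K)) : val K (s.ext γ) = γ := by
  induction γ using WithTop.recTopCoe with
  | top => simp [ext, val]
  | coe γ => exact s.val_toHom γ

theorem norm_ext_val (x : K) : ‖(s.ext (val K x) : PadicAlgCl p)‖ = ‖(x : PadicAlgCl p)‖ :=
  val_eq_val_iff.1 (s.val_ext _)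

theorem ext_nsmul (k : ℕ) (γ : valueGroup K) :
    s.ext ((k • γ : valueGroup K) : WithTop (valueGroup K)) = s.ext γ ^ k := by
  simp [ext]

end CrossSection

namespace IsTotallyRamified

variable (hK : IsTotallyRamified K)
include hK

theorem valueGroup_eq :
    valueGroup K = AddSubgroup.zmultiples (Module.finrank ℚ_[p] K : ℝ)⁻¹ := by
  have := hK.1
  exact isTotallyRamified_iff_valueGroup_eq.1 hK

theorem finrank_pos : 0 < Module.finrank ℚ_[p] K := by
  have := hK.1
  exact Module.finrank_pos

/-- The least positive element `1/[K : ℚ_p]` of the value group. -/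
noncomputable def minPos : valueGroup K :=
  ⟨(Module.finrank ℚ_[p] K : ℝ)⁻¹, hK.valueGroup_eq ▸ AddSubgroup.mem_zmultiples _⟩

theorem minPos_pos : 0 < hK.minPos := by
  have := hK.finrank_pos
  change (0 : ℝ) < (Module.finrank ℚ_[p] K : ℝ)⁻¹
  positivity

theorem exists_nsmul_minPos {γ : valueGroup K} (hγ : 0 ≤ γ) : ∃ k : ℕ, γ = k • hK.minPos := by
  obtain ⟨z, hz⟩ : (γ : ℝ) ∈ AddSubgroup.zmultiples (Module.finrank ℚ_[p] K : ℝ)⁻¹ :=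
    hK.valueGroup_eq ▸ γ.2
  obtain rfl : z • hK.minPos = γ := Subtype.ext hz
  lift z to ℕ using
    (zsmul_le_zsmul_iff_left hK.minPos_pos).1 ((zero_zsmul hK.minPos).trans_le hγ)
  exact ⟨z, natCast_zsmul _ _⟩

theorem isLeast_minPos :
    IsLeast {γ : WithTop (valueGroup K) | 0 < γ} (hK.minPos : WithTop (valueGroup K)) := by
  refine ⟨WithTop.coe_pos.2 hK.minPos_pos, fun δ hδ => ?_⟩
  induction δ using WithTop.recTopCoe with
  | top => exact le_top
  | coe δ =>
    have hδ' : 0 < δ := WithTop.coe_pos.1 hδ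
    obtain ⟨k, rfl⟩ := hK.exists_nsmul_minPos hδ'.le
    have hk : k ≠ 0 := by rintro rfl; simp at hδ'
    exact WithTop.coe_le_coe.2 (le_self_nsmul hK.minPos_pos.le hk)

end IsTotallyRamified

namespace CrossSection

variable (s : CrossSection K) (hK : IsTotallyRamified K)

/-- The uniformizer `s(γ)`, where `γ` is the least positive element of the value group; it is
the lift of `t`. -/
noncomputable def uniformizer : K := s.ext hK.minPos

theorem isUniformizer_uniformizer :
    IsUniformizer (Module.finrank ℚ_[p] K) (s.uniformizer hK : PadicAlgCl p) := by
  have hval : val K (s.uniformizer hK) = hK.minPos := s.val_ext _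
  have h0 : s.uniformizer hK ≠ 0 := fun h => by simp [h, val] at hval
  rw [val, dif_neg h0, WithTop.coe_inj] at hval
  exact (isUniformizer_iff_ord_eq hK.finrank_pos.ne' (by simpa using h0)).2
    (congrArg Subtype.val hval)

theorem ext_val_uniformizer_pow (k : ℕ) :
    s.ext (val K (s.uniformizer hK ^ k)) = s.uniformizer hK ^ k := by
  rw [uniformizer, ← s.ext_nsmul, s.val_ext]

theorem exists_ext_val_eq_uniformizer_pow {x : K} (hx : x ≠ 0) (hx1 : ‖(x : PadicAlgCl p)‖ ≤ 1) :
    ∃ k : ℕ, s.ext (val K x) = s.uniformizer hK ^ k := by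
  have hval : 0 ≤ val K x := val_nonneg_iff.2 hx1
  obtain ⟨γ, hγ⟩ := WithTop.ne_top_iff_exists.1 (show val K x ≠ ⊤ by simp [val, hx])
  rw [← hγ] at hval ⊢
  obtain ⟨k, rfl⟩ := hK.exists_nsmul_minPos (WithTop.coe_nonneg.1 hval)
  exact ⟨k, s.ext_nsmul k _⟩

theorem reduces_uniformizer_pow (k : ℕ) :
    Reduces (s.uniformizer hK : PadicAlgCl p) ((s.uniformizer hK ^ k : K) : PadicAlgCl p)
      (TruncPoly.t p (Module.finrank ℚ_[p] K) ^ k) :=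
  (IntermediateField.coe_pow K _ k).symm ▸ Reduces.uniformizer.pow k

variable {s hK} {x : K} {y : TruncPoly p (Module.finrank ℚ_[p] K)}

theorem eq_zero_or_eq_t_pow_of_norm_sub_ext_val_le
    (h : Reduces (s.uniformizer hK : PadicAlgCl p) x y)
    (hx : ‖(x : PadicAlgCl p) - s.ext (val K x)‖ ≤ (p : ℝ)⁻¹) :
    y = 0 ∨ ∃ k < Module.finrank ℚ_[p] K, y = TruncPoly.t p _ ^ k := by
  have hπ := s.isUniformizer_uniformizer hK
  by_cases hx0 : x = 0
  · refine Or.inl ((h.norm_sub_le_iff hπ .zero).1 ?_)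
    simp [hx0]
  obtain ⟨k, hk⟩ := s.exists_ext_val_eq_uniformizer_pow hK hx0 (h.norm_le_one hπ)
  rw [hk, h.norm_sub_le_iff hπ (s.reduces_uniformizer_pow hK k)] at hx
  rcases lt_or_ge k (Module.finrank ℚ_[p] K) with hkn | hkn
  · exact Or.inr ⟨k, hkn, hx⟩
  · exact Or.inl (hx.trans (TruncPoly.t_pow_eq_zero hkn))

theorem norm_sub_ext_val_le_of_reduces_zero
    (h : Reduces (s.uniformizer hK : PadicAlgCl p) x
      (0 : TruncPoly p (Module.finrank ℚ_[p] K))) :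
    ‖(x : PadicAlgCl p) - s.ext (val K x)‖ ≤ (p : ℝ)⁻¹ := by
  have hx := (h.norm_sub_le_iff (s.isUniformizer_uniformizer hK) .zero).2 rfl
  rw [sub_zero] at hx
  rwa [norm_sub_le_iff_of_norm_le ((s.norm_ext_val x).trans_le hx)]

theorem norm_sub_ext_val_le_of_reduces_t_pow {k : ℕ} (hk : k < Module.finrank ℚ_[p] K)
    (h : Reduces (s.uniformizer hK : PadicAlgCl p) x
      (TruncPoly.t p (Module.finrank ℚ_[p] K) ^ k)) :
    ‖(x : PadicAlgCl p) - s.ext (val K x)‖ ≤ (p : ℝ)⁻¹ := by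
  have hπ := s.isUniformizer_uniformizer hK
  have hle := (h.norm_sub_le_iff hπ (s.reduces_uniformizer_pow hK k)).2 rfl
  have hlt : (p : ℝ)⁻¹ < ‖((s.uniformizer hK ^ k : K) : PadicAlgCl p)‖ := by
    rw [IntermediateField.coe_pow, norm_pow, ← hπ]
    exact pow_lt_pow_right_of_lt_one₀ hπ.norm_pos hπ.norm_lt_one hk
  have hnorm : ‖(x : PadicAlgCl p)‖ = ‖((s.uniformizer hK ^ k : K) : PadicAlgCl p)‖ :=
    norm_eq_of_norm_sub_lt_right (hle.trans_lt hlt)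
  rwa [val_eq_val_iff.2 hnorm, s.ext_val_uniformizer_pow hK k]

theorem norm_sub_ext_val_le_iff (h : Reduces (s.uniformizer hK : PadicAlgCl p) x y) :
    ‖(x : PadicAlgCl p) - s.ext (val K x)‖ ≤ (p : ℝ)⁻¹ ↔
      y = 0 ∨ ∃ k < Module.finrank ℚ_[p] K, y = TruncPoly.t p _ ^ k := by
  refine ⟨eq_zero_or_eq_t_pow_of_norm_sub_ext_val_le h, ?_⟩
  rintro (rfl | ⟨k, hk, rfl⟩)
  · exact norm_sub_ext_val_le_of_reduces_zero h
  · exact norm_sub_ext_val_le_of_reduces_t_pow hk h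

end CrossSection

end PadicExt

namespace Lval

/-! ## The translation of existential `L_t ∪ {P}`-sentences -/

/-- Negation. -/
def Formula.neg (φ : Formula) : Formula := φ.imp .falsum

/-- Conjunction. -/
def Formula.conj (φ ψ : Formula) : Formula := (φ.imp ψ.neg).neg

/-- The numeral `1 + ⋯ + 1` of the field sort. -/
def Term.numeral : ℕ → Term .K
  | 0 => .zeroK
  | k + 1 => .addK (numeral k) .oneK

/-- Congruence `a ≡ b` modulo `p`, for `b` integral. The language has no subtraction, so `a - b` is
replaced by `a + (p - 1) b`. -/
def Formula.congr (p : ℕ) (a b : Term .K) : Formula :=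
  (Formula.lt (.v (.addK a (.mulK (.numeral (p - 1)) b))) (.v (.numeral p))).neg

/-- Integrality `v(x_0), …, v(x_{m-1}) ≥ 0` of field variables, in conjunction with `φ`. -/
def Formula.integral : ℕ → Formula → Formula
  | 0, φ => φ
  | m + 1, φ => .conj (Formula.neg (.lt (.v (.var .K m)) .zeroΓ)) (integral m φ)

/-- Existential quantification over the field variables `x_0, …, x_{m-1}`. -/
def Formula.exK : ℕ → Formula → Formula
  | 0, φ => φ
  | m + 1, φ => .ex .K m (exK m φ)

/-- The matrix stating that `γ_0` is the least positive value, where `γ_1` is the variable to be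
quantified universally. -/
def Formula.leastPos : Formula :=
  .conj (.lt .zeroΓ (.var .Γ 0))
    (.imp (.lt .zeroΓ (.var .Γ 1)) (Formula.neg (.lt (.var .Γ 1) (.var .Γ 0))))

/-- The `∃∀`-sentence stating that `φ` is satisfied by the least positive value `γ_0` and some
integral `x_0, …, x_{m-1}`. -/
def Formula.closure (m : ℕ) (φ : Formula) : Formula :=
  .ex .Γ 0 (.exK m (.all .Γ 1 (leastPos.conj (φ.integral m))))

/-- The lift of a term of `L_t`: the constant `t` becomes `s(γ_0)`. -/
def liftTerm {m : ℕ} : LtP.Term (Empty ⊕ Fin m) → Term .K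
  | .var (Sum.inl e) => e.elim
  | .var (Sum.inr i) => .var .K i
  | .func LtFunc.zero _ => .zeroK
  | .func LtFunc.one _ => .oneK
  | .func LtFunc.t _ => .s (.var .Γ 0)
  | .func LtFunc.add ts => .addK (liftTerm (ts 0)) (liftTerm (ts 1))
  | .func LtFunc.mul ts => .mulK (liftTerm (ts 0)) (liftTerm (ts 1))

/-- The lift of a quantifier-free formula: equality becomes congruence modulo `p`, and `P(τ)`
becomes `τ ≡ s(v(τ))`. Quantified formulas are sent to `⊥`. -/
def liftFormula (p : ℕ) {m : ℕ} : LtP.BoundedFormula Empty m → Formula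
  | .falsum => .falsum
  | .equal a b => .congr p (liftTerm a) (liftTerm b)
  | .rel LtRel.P ts => .congr p (liftTerm (ts 0)) (.s (.v (liftTerm (ts 0))))
  | .imp φ ψ => .imp (liftFormula p φ) (liftFormula p ψ)
  | .all _ => .falsum

namespace Formula

theorem IsQF.neg {φ : Formula} (h : φ.IsQF) : φ.neg.IsQF := .imp h .falsum

theorem IsQF.conj {φ ψ : Formula} (h : φ.IsQF) (h' : ψ.IsQF) : (φ.conj ψ).IsQF :=
  (IsQF.imp h h'.neg).neg

theorem isQF_congr (p : ℕ) (a b : Term .K) : (congr p a b).IsQF := (IsQF.lt _ _).neg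

theorem isQF_leastPos : leastPos.IsQF := (IsQF.lt _ _).conj (.imp (.lt _ _) (IsQF.lt _ _).neg)

theorem IsQF.integral {φ : Formula} (h : φ.IsQF) (m : ℕ) : (φ.integral m).IsQF := by
  induction m with
  | zero => exact h
  | succ m ih => exact (IsQF.lt _ _).neg.conj ih

theorem IsExistsForall.exK {φ : Formula} (h : φ.IsExistsForall) (m : ℕ) :
    (φ.exK m).IsExistsForall := by
  induction m with
  | zero => exact h
  | succ m ih => exact .ex _ _ ih

theorem IsQF.isExistsForall_closure {φ : Formula} (h : φ.IsQF) (m : ℕ) :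
    (φ.closure m).IsExistsForall :=
  .ex _ _ (IsExistsForall.exK
    (.of_isUniversal (.all _ _ (.of_isQF (isQF_leastPos.conj (h.integral m))))) _)

end Formula

theorem isQF_liftFormula (p : ℕ) {m : ℕ} (φ : LtP.BoundedFormula Empty m) :
    (liftFormula p φ).IsQF := by
  induction φ with
  | falsum => exact .falsum
  | equal a b => exact Formula.isQF_congr _ _ _
  | rel R ts => cases R; exact Formula.isQF_congr _ _ _
  | imp φ ψ ih ih' => exact .imp ih ih'
  | all _ _ => exact .falsum

theorem Term.vars_numeral (k : ℕ) : (Term.numeral k).vars = ∅ := by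
  induction k with
  | zero => rfl
  | succ k ih => simp only [numeral, vars, ih, Set.union_empty]

/-- The variables that may occur in the lift of a formula in `m` variables. -/
def liftVars (m : ℕ) : Set (Srt × ℕ) := {x | x = (.Γ, 0) ∨ ∃ i < m, x = (.K, i)}

theorem vars_liftTerm {m : ℕ} (τ : LtP.Term (Empty ⊕ Fin m)) :
    (liftTerm τ).vars ⊆ liftVars m := by
  induction τ with
  | var x =>
    rcases x with e | i
    · exact e.elim
    · exact Set.singleton_subset_iff.2 (Or.inr ⟨i, i.2, rfl⟩)
  | func f ts ih =>
    cases f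
    · exact Set.empty_subset _
    · exact Set.empty_subset _
    · exact Set.singleton_subset_iff.2 (Or.inl rfl)
    · exact Set.union_subset (ih 0) (ih 1)
    · exact Set.union_subset (ih 0) (ih 1)

theorem Formula.freeVars_congr (p : ℕ) (a b : Term .K) :
    (congr p a b).freeVars = a.vars ∪ b.vars := by
  simp only [congr, neg, freeVars, Term.vars, Term.vars_numeral, Set.empty_union, Set.union_empty]

theorem freeVars_liftFormula (p : ℕ) {m : ℕ} (φ : LtP.BoundedFormula Empty m) :
    (liftFormula p φ).freeVars ⊆ liftVars m := by
  induction φ with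
  | falsum => exact Set.empty_subset _
  | equal a b =>
    exact (Formula.freeVars_congr p _ _).trans_subset
      (Set.union_subset (vars_liftTerm a) (vars_liftTerm b))
  | rel R ts =>
    cases R
    exact (Formula.freeVars_congr p _ _).trans_subset
      (Set.union_subset (vars_liftTerm (ts 0)) (vars_liftTerm (ts 0)))
  | imp φ ψ ih ih' => exact Set.union_subset ih ih'
  | all _ _ => exact Set.empty_subset _

namespace Formula

theorem freeVars_conj (φ ψ : Formula) : (φ.conj ψ).freeVars = φ.freeVars ∪ ψ.freeVars := by
  simp only [conj, neg, freeVars, Set.union_empty]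

theorem freeVars_leastPos : leastPos.freeVars = {(.Γ, 0), (.Γ, 1)} := by
  simp only [leastPos, freeVars_conj, freeVars, neg, Term.vars]
  grind

theorem freeVars_integral (m : ℕ) (φ : Formula) :
    (φ.integral m).freeVars ⊆ φ.freeVars ∪ liftVars m := by
  induction m with
  | zero => exact Set.subset_union_left
  | succ m ih =>
    simp only [integral, freeVars_conj, neg, freeVars, Term.vars, Set.union_empty]
    refine Set.union_subset (Set.singleton_subset_iff.2 (.inr (.inr ⟨m, m.lt_succ_self, rfl⟩))) ?_
    refine ih.trans (Set.union_subset_union_right _ fun x hx => hx.imp_right ?_)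
    exact fun ⟨i, hi, hx⟩ => ⟨i, hi.trans m.lt_succ_self, hx⟩

theorem freeVars_exK (m : ℕ) (φ : Formula) :
    (φ.exK m).freeVars = {x ∈ φ.freeVars | ∀ i < m, x ≠ (.K, i)} := by
  induction m with
  | zero => simp [exK]
  | succ m ih =>
    ext x
    simp only [exK, freeVars, ih, Set.mem_sdiff, Set.mem_ofPred_eq, Set.mem_singleton_iff,
      and_assoc, Nat.forall_lt_succ_right]

theorem isSentence_closure {m : ℕ} {φ : Formula} (h : φ.freeVars ⊆ liftVars m) :
    (φ.closure m).IsSentence := by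
  refine Set.eq_empty_iff_forall_notMem.2 ?_
  simp only [closure, freeVars, freeVars_exK, freeVars_conj, freeVars_leastPos]
  rintro x ⟨⟨⟨(hx | hx), hx1⟩, hxK⟩, hx0⟩
  · exact hx.elim hx0 hx1
  · rcases Set.union_subset h subset_rfl (freeVars_integral m φ hx) with hx | ⟨i, hi, hx⟩
    · exact hx0 hx
    · exact hxK i hi hx

end Formula

namespace Str.Assignment

variable {M : Str} (a : M.Assignment) {m : ℕ}

instance : Nonempty M.Assignment :=
  ⟨fun
    | (.K, _) => M.zeroK
    | (.Γ, _) => M.zeroΓ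
    | (.k, _) => M.zerok⟩

/-- The assignment that agrees with `a`, except that `x_0, …, x_{m-1}` take the values `x`. -/
def updateK (x : Fin m → M.carrier .K) : M.Assignment
  | (.K, i) => if h : i < m then x ⟨i, h⟩ else a (.K, i)
  | (.Γ, i) => a (.Γ, i)
  | (.k, i) => a (.k, i)

theorem updateK_zero (x : Fin 0 → M.carrier .K) : a.updateK x = a := by
  funext ⟨σ, i⟩
  cases σ <;> rfl

open Classical in
theorem updateK_succ (x : Fin (m + 1) → M.carrier .K) :
    a.updateK x = updateK (Function.update a (.K, m) (x (Fin.last m))) (Fin.init x) := by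
  funext ⟨σ, i⟩
  cases σ with
  | K =>
    rcases lt_trichotomy i m with hi | rfl | hi
    · simp [updateK, hi, hi.trans m.lt_succ_self, Fin.init]
    · simp [updateK, Fin.last]
    · simp [updateK, hi.not_gt, hi.ne', (Nat.succ_le_of_lt hi).not_gt]
  | _ => simp [updateK]

open Classical in
/-- The assignment under which the matrix of `Formula.closure` is evaluated: `γ` and `δ` are the
values of `γ_0` and `γ_1`, and `x` is the tuple of values of the field variables. -/
noncomputable def ofClosure (γ : M.carrier .Γ) (x : Fin m → M.carrier .K) (δ : M.carrier .Γ) :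
    M.Assignment :=
  Function.update (updateK (Function.update a (.Γ, 0) γ) x) (.Γ, 1) δ

variable (γ δ : M.carrier .Γ) (x : Fin m → M.carrier .K)

theorem ofClosure_Γ_zero : a.ofClosure γ x δ (.Γ, 0) = γ := by simp [ofClosure, updateK]

theorem ofClosure_Γ_one : a.ofClosure γ x δ (.Γ, 1) = δ := by simp [ofClosure]

theorem ofClosure_K (i : Fin m) : a.ofClosure γ x δ (.K, i) = x i := by simp [ofClosure, updateK]

end Str.Assignment

namespace Formula

variable {M : Str} {a : M.Assignment} {m : ℕ} {φ ψ : Formula}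

theorem realize_neg : φ.neg.Realize M a ↔ ¬ φ.Realize M a := Iff.rfl

theorem realize_conj : (φ.conj ψ).Realize M a ↔ φ.Realize M a ∧ ψ.Realize M a := by
  simp only [conj, realize_neg, Realize, Classical.not_imp, not_not]

theorem realize_leastPos :
    leastPos.Realize M a ↔ M.ltΓ M.zeroΓ (a (.Γ, 0)) ∧
      (M.ltΓ M.zeroΓ (a (.Γ, 1)) → ¬ M.ltΓ (a (.Γ, 1)) (a (.Γ, 0))) := by
  simp only [leastPos, realize_conj, Realize, realize_neg, Term.eval]

theorem realize_integral :
    (φ.integral m).Realize M a ↔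
      (∀ i : Fin m, ¬ M.ltΓ (M.v (a (.K, i))) M.zeroΓ) ∧ φ.Realize M a := by
  induction m with
  | zero => simp [integral]
  | succ m ih =>
    simp only [integral, realize_conj, ih, realize_neg, Realize, Term.eval, Fin.forall_fin_succ',
      Fin.val_castSucc, Fin.val_last]
    tauto

theorem realize_exK :
    (φ.exK m).Realize M a ↔ ∃ x : Fin m → M.carrier .K, φ.Realize M (a.updateK x) := by
  induction m generalizing a with
  | zero => simp [exK, a.updateK_zero]
  | succ m ih =>
    simp only [exK, Realize, ih, a.updateK_succ]
    refine ⟨fun ⟨c, x, h⟩ => ⟨Fin.snoc x c, ?_⟩, fun ⟨x, h⟩ => ⟨_, _, h⟩⟩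
    rwa [Fin.snoc_last, Fin.init_snoc]

theorem realize_closure :
    (φ.closure m).Realize M a ↔ ∃ (γ : M.carrier .Γ) (x : Fin m → M.carrier .K),
      ∀ δ : M.carrier .Γ,
        (M.ltΓ M.zeroΓ γ ∧ (M.ltΓ M.zeroΓ δ → ¬ M.ltΓ δ γ)) ∧
        (∀ i, ¬ M.ltΓ (M.v (x i)) M.zeroΓ) ∧ φ.Realize M (a.ofClosure γ x δ) := by
  simp only [closure, Realize, realize_exK]
  refine exists₂_congr fun γ x => forall_congr' fun δ => ?_
  change (leastPos.conj (φ.integral m)).Realize M (a.ofClosure γ x δ) ↔ _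
  simp only [realize_conj, realize_leastPos, realize_integral, a.ofClosure_Γ_zero,
    a.ofClosure_Γ_one, a.ofClosure_K]

end Formula

end Lval

namespace PadicExt

open Lval FirstOrder.Language

variable {p : ℕ} [Fact p.Prime] {K : IntermediateField ℚ_[p] (PadicAlgCl p)} {m : ℕ}

theorem norm_natCast_prime : ‖((p : K) : PadicAlgCl p)‖ = (p : ℝ)⁻¹ := by
  rw [← Padic.norm_p, ← PadicAlgCl.norm_extends]
  simp

namespace CrossSection

variable (s : CrossSection K) (a : (padicStr K s).Assignment)

/-- The value of a field term, as an element of `K`. -/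
noncomputable def evalK (τ : Lval.Term .K) : K := τ.eval (padicStr K s) a

theorem evalK_numeral (k : ℕ) : s.evalK a (.numeral k) = k := by
  induction k with
  | zero => exact Nat.cast_zero.symm
  | succ k ih =>
    rw [Nat.cast_succ, ← ih]
    rfl

theorem realize_congr {τ σ : Lval.Term .K} (hσ : ‖(s.evalK a σ : PadicAlgCl p)‖ ≤ 1) :
    (Formula.congr p τ σ).Realize (padicStr K s) a ↔
      ‖(s.evalK a τ : PadicAlgCl p) - s.evalK a σ‖ ≤ (p : ℝ)⁻¹ := by
  change ¬ val K (s.evalK a τ + s.evalK a (.numeral (p - 1)) * s.evalK a σ) <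
    val K (s.evalK a (.numeral p)) ↔ _
  have hp : ‖(p : PadicAlgCl p) * s.evalK a σ‖ ≤ (p : ℝ)⁻¹ := by
    rw [norm_mul, ← norm_natCast_prime (K := K)]
    exact mul_le_of_le_one_right (norm_nonneg _) hσ
  rw [val_lt_val_iff, not_lt, s.evalK_numeral, s.evalK_numeral, norm_natCast_prime,
    ← norm_sub_le_iff_of_norm_le hp, Nat.cast_pred (Fact.out : p.Prime).pos]
  push_cast
  ring_nf

variable {s a} {hK : IsTotallyRamified K} {y : Fin m → TruncPoly p (Module.finrank ℚ_[p] K)}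
  {e : Empty → TruncPoly p (Module.finrank ℚ_[p] K)}

theorem reduces_liftTerm (hγ : a (.Γ, 0) = (hK.minPos : WithTop (valueGroup K)))
    (hy : ∀ i : Fin m, Reduces (s.uniformizer hK : PadicAlgCl p) (s.evalK a (.var .K i)) (y i))
    (τ : LtP.Term (Empty ⊕ Fin m)) :
    Reduces (s.uniformizer hK : PadicAlgCl p) (s.evalK a (liftTerm τ))
      (τ.realize (Sum.elim e y)) := by
  induction τ with
  | var x =>
    rcases x with x | i
    · exact x.elim
    · exact hy i
  | func f ts ih =>
    cases f
    · exact .zero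
    · exact .one
    · have ht : s.evalK a (liftTerm (.func LtFunc.t ts)) = s.uniformizer hK := congrArg s.ext hγ
      rw [ht]
      exact .uniformizer
    · exact (ih 0).add (ih 1)
    · exact (ih 0).mul (ih 1)

theorem realize_liftFormula (hγ : a (.Γ, 0) = (hK.minPos : WithTop (valueGroup K)))
    (hy : ∀ i : Fin m, Reduces (s.uniformizer hK : PadicAlgCl p) (s.evalK a (.var .K i)) (y i))
    {φ : LtP.BoundedFormula Empty m} (hφ : φ.IsQF) :
    (liftFormula p φ).Realize (padicStr K s) a ↔ φ.Realize e y := by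
  have hπ := s.isUniformizer_uniformizer hK
  induction hφ with
  | falsum => exact Iff.rfl
  | of_isAtomic h =>
    cases h with
    | equal τ σ =>
      have hσ := reduces_liftTerm (e := e) hγ hy σ
      exact (s.realize_congr a (hσ.norm_le_one hπ)).trans
        ((reduces_liftTerm hγ hy τ).norm_sub_le_iff hπ hσ)
    | rel R ts =>
      cases R
      have hτ := reduces_liftTerm (e := e) hγ hy (ts 0)
      refine (s.realize_congr a ?_).trans (norm_sub_ext_val_le_iff hτ)
      exact (s.norm_ext_val _).trans_le (hτ.norm_le_one hπ)
  | imp _ _ ih ih' => exact imp_congr ih ih'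

variable (s hK)

theorem realize_closure {φ : Lval.Formula} :
    (φ.closure m).Realize (padicStr K s) a ↔
      ∃ x : Fin m → K, (∀ i, ‖(x i : PadicAlgCl p)‖ ≤ 1) ∧ ∀ δ,
        φ.Realize (padicStr K s) (a.ofClosure (hK.minPos : WithTop (valueGroup K)) x δ) := by
  have hleast (γ : WithTop (valueGroup K)) :
      (0 < γ ∧ ∀ δ : WithTop (valueGroup K), 0 < δ → γ ≤ δ) ↔ γ = hK.minPos :=
    ⟨fun h => IsLeast.unique (s := {γ | 0 < γ}) h hK.isLeast_minPos,
      fun h => h ▸ hK.isLeast_minPos⟩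
  rw [Formula.realize_closure]
  change (∃ (γ : WithTop (valueGroup K)) (x : Fin m → K), ∀ δ : WithTop (valueGroup K),
    (0 < γ ∧ (0 < δ → ¬ δ < γ)) ∧ (∀ i, ¬ val K (x i) < 0) ∧
      φ.Realize (padicStr K s) (a.ofClosure γ x δ)) ↔ _
  simp only [forall_and, forall_const, not_lt, hleast, exists_and_left, exists_eq_left,
    val_nonneg_iff]
  rfl

theorem realize_liftFormula_ofClosure {x : Fin m → K}
    (hxy : ∀ i, Reduces (s.uniformizer hK : PadicAlgCl p) (x i) (y i))
    {φ : LtP.BoundedFormula Empty m} (hφ : φ.IsQF) (δ : WithTop (valueGroup K)) :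
    (liftFormula p φ).Realize (padicStr K s)
      (a.ofClosure (hK.minPos : WithTop (valueGroup K)) x δ) ↔ φ.Realize e y := by
  refine realize_liftFormula (a.ofClosure_Γ_zero _ _ _) (fun i => ?_) hφ
  have hx : s.evalK (a.ofClosure (hK.minPos : WithTop (valueGroup K)) x δ) (.var .K i) = x i :=
    a.ofClosure_K _ _ _ i
  exact hx ▸ hxy i

include hK in
theorem models_closure_liftFormula_iff {φ : LtP.BoundedFormula Empty m} (hφ : φ.IsQF) :
    (padicStr K s).Models ((liftFormula p φ).closure m) ↔
      TruncPoly p (Module.finrank ℚ_[p] K) ⊨ φ.exs := by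
  have hπ := s.isUniformizer_uniformizer hK
  have hmem : (s.uniformizer hK : PadicAlgCl p) ∈ K := Subtype.coe_prop _
  rw [Sentence.Realize, BoundedFormula.realize_exs]
  simp only [Str.Models, s.realize_closure hK]
  constructor
  · intro h
    obtain ⟨x, hx, hφx⟩ := h (Classical.arbitrary _)
    choose y hy using fun i => hπ.exists_reduces_right hmem rfl (x i).2 (hx i)
    exact ⟨y, (s.realize_liftFormula_ofClosure hK hy hφ 0).1 (hφx _)⟩
  · rintro ⟨y, hy⟩ a
    choose x hxK hxy using fun i => exists_reduces_left hmem (y i)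
    exact ⟨fun i => ⟨x i, hxK i⟩, fun i => (hxy i).norm_le_one hπ,
      fun δ => (s.realize_liftFormula_ofClosure hK hxy hφ δ).2 hy⟩

end CrossSection

end PadicExt

/-! ## Computability of the translation -/

section Primrec

open Nat (pair)

variable {α : Type*} [Primcodable α]

theorem primrec_pair {f g : α → ℕ} (hf : Primrec f) (hg : Primrec g) :
    Primrec fun a => pair (f a) (g a) :=
  Primrec₂.natPair.comp hf hg

theorem primrec_unpair_fst {f : α → ℕ} (hf : Primrec f) : Primrec fun a => (f a).unpair.1 :=
  Primrec.fst.comp (Primrec.unpair.comp hf)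

theorem primrec_unpair_snd {f : α → ℕ} (hf : Primrec f) : Primrec fun a => (f a).unpair.2 :=
  Primrec.snd.comp (Primrec.unpair.comp hf)

theorem getD_map_range (f : ℕ → ℕ) {a c : ℕ} (h : a < c) :
    (List.map f (List.range c)).getD a 0 = f a := by
  simp [List.getD_eq_getElem?_getD, List.getElem?_range h]

theorem primrec₂_of_course_of_values {f : ℕ → ℕ → ℕ} {l r : ℕ → ℕ} {G : ℕ × ℕ → ℕ × ℕ → ℕ}
    (hl : Primrec l) (hr : Primrec r) (hG : Primrec₂ G)
    (hf : ∀ m c x y, (l c < c → x = f m (l c)) → (r c < c → y = f m (r c)) →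
      f m c = G (m, c) (x, y)) :
    Primrec₂ f := by
  have hlen : Primrec fun q : ℕ × List ℕ => q.2.length := Primrec.list_length.comp Primrec.snd
  have hget {h : ℕ → ℕ} (hh : Primrec h) :
      Primrec fun q : ℕ × List ℕ => q.2.getD (h q.2.length) 0 :=
    (Primrec.list_getD 0).comp Primrec.snd (hh.comp hlen)
  refine Primrec.nat_strong_rec f (g := fun m L =>
    some (G (m, L.length) (L.getD (l L.length) 0, L.getD (r L.length) 0)))
    (Primrec.option_some.comp
      (hG.comp (Primrec.fst.pair hlen) ((hget hl).pair (hget hr)))) fun m c => ?_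
  rw [List.length_map, List.length_range]
  exact congrArg some (hf m c _ _ (getD_map_range (f m)) (getD_map_range (f m))).symm

end Primrec

namespace LtP

open FirstOrder.Language
open Nat (pair)

/-- The code of the first argument of the function application coded by `c`. -/
def argFst (c : ℕ) : ℕ := (c.unpair.2.unpair.2 - 1).unpair.1

/-- The code of the second argument of the function application coded by `c`. -/
def argSnd (c : ℕ) : ℕ := ((c.unpair.2.unpair.2 - 1).unpair.2 - 1).unpair.1

theorem unpair_snd_lt {c : ℕ} (hc : c.unpair.1 ≠ 0) : c.unpair.2 < c := by
  have h := Nat.add_le_pair c.unpair.1 c.unpair.2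
  rw [Nat.pair_unpair] at h
  omega

theorem argFst_lt {c : ℕ} (hc : c.unpair.1 ≠ 0) : argFst c < c :=
  (Nat.unpair_left_le _).trans_lt <| (Nat.sub_le _ _).trans_lt <|
    (Nat.unpair_right_le _).trans_lt (unpair_snd_lt hc)

theorem argSnd_lt {c : ℕ} (hc : c.unpair.1 ≠ 0) : argSnd c < c :=
  (Nat.unpair_left_le _).trans_lt <| (Nat.sub_le _ _).trans_lt <|
    (Nat.unpair_right_le _).trans_lt <| (Nat.sub_le _ _).trans_lt <|
    (Nat.unpair_right_le _).trans_lt (unpair_snd_lt hc)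

/-- The term in `m` variables with code `c`, with an arbitrary value on the other numbers. -/
def decodeTerm (m c : ℕ) : LtP.Term (Empty ⊕ Fin m) :=
  if _ : c.unpair.1 = 0 then
    if hi : c.unpair.2 < m then .var (Sum.inr ⟨c.unpair.2, hi⟩) else .func LtFunc.zero ![]
  else if c.unpair.2.unpair.1 = funcCode .one then .func LtFunc.one ![]
  else if c.unpair.2.unpair.1 = funcCode .t then .func LtFunc.t ![]
  else if c.unpair.2.unpair.1 = funcCode .add then
    .func LtFunc.add ![decodeTerm m (argFst c), decodeTerm m (argSnd c)]
  else if c.unpair.2.unpair.1 = funcCode .mul then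
    .func LtFunc.mul ![decodeTerm m (argFst c), decodeTerm m (argSnd c)]
  else .func LtFunc.zero ![]
termination_by c
decreasing_by exacts [argFst_lt ‹_›, argSnd_lt ‹_›, argFst_lt ‹_›, argSnd_lt ‹_›]

theorem decodeTerm_termCode {m : ℕ} (τ : LtP.Term (Empty ⊕ Fin m)) :
    decodeTerm m (termCode τ) = τ := by
  induction τ with
  | var x =>
    rcases x with e | i
    · exact e.elim
    · rw [decodeTerm]
      simp [termCode]
  | func f ts ih =>
    rw [decodeTerm]
    cases f
    case zero | one | t => simp [termCode, funcCode, Matrix.empty_eq]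
    case add | mul =>
      have hts : ![ts 0, ts 1] = ts := funext (Fin.forall_fin_two.2 ⟨rfl, rfl⟩)
      simp [termCode, funcCode, argFst, argSnd, ih, List.ofFn_succ, hts]

theorem primrec₂_fold_decodeTerm {F : ∀ {m : ℕ}, LtP.Term (Empty ⊕ Fin m) → ℕ} {V : ℕ → ℕ}
    {C : LtFunc 0 → ℕ} {A : LtFunc 2 → ℕ → ℕ → ℕ} (hV : Primrec V) (hA : ∀ f, Primrec₂ (A f))
    (hFV : ∀ {m} (i : Fin m), F (.var (Sum.inr i)) = V i)
    (hFC : ∀ {m} f (ts : Fin 0 → LtP.Term (Empty ⊕ Fin m)), F (.func f ts) = C f)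
    (hFA : ∀ {m} f (ts : Fin 2 → LtP.Term (Empty ⊕ Fin m)),
      F (.func f ts) = A f (F (ts 0)) (F (ts 1))) :
    Primrec₂ fun m c => F (decodeTerm m c) := by
  have hsnd : Primrec fun c : ℕ => c.unpair.2 := primrec_unpair_snd .id
  have harg : Primrec fun c : ℕ => c.unpair.2.unpair.2 - 1 :=
    Primrec.pred.comp (primrec_unpair_snd hsnd)
  have hc : Primrec fun q : (ℕ × ℕ) × ℕ × ℕ => q.1.2 := Primrec.snd.comp Primrec.fst
  have hvar : PrimrecPred fun q : (ℕ × ℕ) × ℕ × ℕ => q.1.2.unpair.1 = 0 :=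
    Primrec.eq.comp (primrec_unpair_fst hc) (.const 0)
  have hlt : PrimrecPred fun q : (ℕ × ℕ) × ℕ × ℕ => q.1.2.unpair.2 < q.1.1 :=
    Primrec.nat_lt.comp (hsnd.comp hc) (Primrec.fst.comp Primrec.fst)
  have hfunc (k : ℕ) : PrimrecPred fun q : (ℕ × ℕ) × ℕ × ℕ => q.1.2.unpair.2.unpair.1 = k :=
    Primrec.eq.comp (primrec_unpair_fst (hsnd.comp hc)) (.const k)
  have hvals (f : LtFunc 2) : Primrec fun q : (ℕ × ℕ) × ℕ × ℕ => A f q.2.1 q.2.2 :=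
    (hA f).comp (Primrec.fst.comp Primrec.snd) (Primrec.snd.comp Primrec.snd)
  refine primrec₂_of_course_of_values (l := argFst) (r := argSnd)
    (primrec_unpair_fst harg)
    (primrec_unpair_fst (Primrec.pred.comp (primrec_unpair_snd harg)))
    (Primrec.ite hvar (Primrec.ite hlt (hV.comp (hsnd.comp hc)) (.const (C .zero)))
      (Primrec.ite (hfunc (funcCode .one)) (.const (C .one))
      (Primrec.ite (hfunc (funcCode .t)) (.const (C .t))
      (Primrec.ite (hfunc (funcCode .add)) (hvals .add)
      (Primrec.ite (hfunc (funcCode .mul)) (hvals .mul) (.const (C .zero))))))).to₂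
    fun m c x y hx hy => ?_
  rw [decodeTerm]
  split_ifs with h0
  · exact hFV _
  · exact hFC _ _
  · exact hFC _ _
  · exact hFC _ _
  · exact (hFA _ _).trans
      (congrArg₂ (A .add) (hx (argFst_lt h0)).symm (hy (argSnd_lt h0)).symm)
  · exact (hFA _ _).trans
      (congrArg₂ (A .mul) (hx (argFst_lt h0)).symm (hy (argSnd_lt h0)).symm)
  · exact hFC _ _

/-- The quantifier-free formula in `m` variables with code `c`, with an arbitrary quantifier-free
value on the other numbers. -/
def decodeFormula (m c : ℕ) : LtP.BoundedFormula Empty m :=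
  if c.unpair.1 = 1 then
    .equal (decodeTerm m c.unpair.2.unpair.1) (decodeTerm m c.unpair.2.unpair.2)
  else if c.unpair.1 = 2 then .rel LtRel.P ![decodeTerm m (c.unpair.2 - 1).unpair.1]
  else if _ : c.unpair.1 = 3 then
    .imp (decodeFormula m c.unpair.2.unpair.1) (decodeFormula m c.unpair.2.unpair.2)
  else .falsum
termination_by c
decreasing_by
  · exact (Nat.unpair_left_le _).trans_lt (unpair_snd_lt (by lia))
  · exact (Nat.unpair_right_le _).trans_lt (unpair_snd_lt (by lia))

theorem isQF_decodeFormula (m c : ℕ) : (decodeFormula m c).IsQF := by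
  induction c using Nat.strong_induction_on with
  | _ c ih =>
    rw [decodeFormula]
    split_ifs
    · exact (BoundedFormula.IsAtomic.equal _ _).isQF
    · exact (BoundedFormula.IsAtomic.rel _ _).isQF
    · have hc : c.unpair.2 < c := unpair_snd_lt (by lia)
      exact (ih _ ((Nat.unpair_left_le _).trans_lt hc)).imp
        (ih _ ((Nat.unpair_right_le _).trans_lt hc))
    · exact .falsum

theorem decodeFormula_code {m : ℕ} {φ : LtP.BoundedFormula Empty m} (hφ : φ.IsQF) :
    decodeFormula m (code φ) = φ := by
  induction hφ with
  | falsum => rw [decodeFormula]; simp [code]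
  | of_isAtomic h =>
    rw [decodeFormula]
    cases h with
    | equal a b => simp [code, Term.bdEqual, decodeTerm_termCode]
    | rel R ts =>
      cases R
      have hts : ![ts 0] = ts := funext (Fin.forall_fin_one.2 rfl)
      simp [code, Relations.boundedFormula, decodeTerm_termCode, hts]
  | imp _ _ ih ih' =>
    rw [decodeFormula]
    simp [code, ih, ih']

theorem primrec₂_fold_decodeFormula {T : ∀ {m : ℕ}, LtP.Term (Empty ⊕ Fin m) → ℕ}
    {F : ∀ {m : ℕ}, LtP.BoundedFormula Empty m → ℕ} {z : ℕ} {E I : ℕ → ℕ → ℕ} {R : ℕ → ℕ}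
    (hT : Primrec₂ fun m c => T (decodeTerm m c))
    (hE : Primrec₂ E) (hR : Primrec R) (hI : Primrec₂ I)
    (hFz : ∀ {m}, F (.falsum : LtP.BoundedFormula Empty m) = z)
    (hFE : ∀ {m} (a b : LtP.Term (Empty ⊕ Fin m)), F (.equal a b) = E (T a) (T b))
    (hFR : ∀ {m} (ts : Fin 1 → LtP.Term (Empty ⊕ Fin m)), F (.rel LtRel.P ts) = R (T (ts 0)))
    (hFI : ∀ {m} (φ ψ : LtP.BoundedFormula Empty m), F (φ.imp ψ) = I (F φ) (F ψ)) :
    Primrec₂ fun m c => F (decodeFormula m c) := by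
  have hm : Primrec fun q : (ℕ × ℕ) × ℕ × ℕ => q.1.1 := Primrec.fst.comp Primrec.fst
  have hc : Primrec fun q : (ℕ × ℕ) × ℕ × ℕ => q.1.2 := Primrec.snd.comp Primrec.fst
  have hsnd : Primrec fun c : ℕ => c.unpair.2 := primrec_unpair_snd .id
  have htag (k : ℕ) : PrimrecPred fun q : (ℕ × ℕ) × ℕ × ℕ => q.1.2.unpair.1 = k :=
    Primrec.eq.comp (primrec_unpair_fst hc) (.const k)
  refine primrec₂_of_course_of_values (l := fun c => c.unpair.2.unpair.1)
    (r := fun c => c.unpair.2.unpair.2) (primrec_unpair_fst hsnd) (primrec_unpair_snd hsnd)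
    (Primrec.ite (htag 1) (hE.comp (hT.comp hm (primrec_unpair_fst (hsnd.comp hc)))
        (hT.comp hm (primrec_unpair_snd (hsnd.comp hc))))
      (Primrec.ite (htag 2)
        (hR.comp (hT.comp hm (primrec_unpair_fst (Primrec.pred.comp (hsnd.comp hc)))))
      (Primrec.ite (htag 3)
        (hI.comp (Primrec.fst.comp Primrec.snd) (Primrec.snd.comp Primrec.snd))
        (.const z)))).to₂
    fun m c x y hx hy => ?_
  rw [decodeFormula]
  split_ifs
  · exact hFE _ _
  · exact hFR _
  · have hc : c.unpair.2 < c := unpair_snd_lt (by lia)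
    rw [hFI, hx ((Nat.unpair_left_le _).trans_lt hc), hy ((Nat.unpair_right_le _).trans_lt hc)]
  · exact hFz

theorem primrec₂_code_decodeFormula : Primrec₂ fun m c => code (decodeFormula m c) := by
  have happ (k : ℕ) : Primrec₂ fun x y => pair 1 (pair k (pair x (pair y 0 + 1) + 1)) :=
    primrec_pair (.const 1) (primrec_pair (.const k) (Primrec.succ.comp
      (primrec_pair .fst (Primrec.succ.comp (primrec_pair .snd (.const 0))))))
  have hpair (k : ℕ) : Primrec₂ fun x y => pair k (pair x y) :=
    primrec_pair (.const k) (primrec_pair .fst .snd)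
  have hT : Primrec₂ fun m c => termCode (decodeTerm m c) :=
    primrec₂_fold_decodeTerm (F := termCode) (V := pair 0)
      (C := fun f => pair 1 (pair (funcCode f) 0))
      (A := fun f x y => pair 1 (pair (funcCode f) (pair x (pair y 0 + 1) + 1)))
      (primrec_pair (.const 0) .id) (fun f => happ (funcCode f))
      (fun _ => rfl) (fun _ _ => rfl) (fun _ _ => rfl)
  exact primrec₂_fold_decodeFormula (F := code) (R := fun x => pair 2 (pair x 0 + 1)) hT (hpair 1)
    (primrec_pair (.const 2) (Primrec.succ.comp (primrec_pair .id (.const 0)))) (hpair 3)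
    rfl (fun _ _ => rfl) (fun _ => rfl) (fun _ _ => rfl)

/-- The code of `φ.ex` in terms of the code of `φ`. -/
def exCode (c : ℕ) : ℕ := pair 3 (pair (pair 4 (pair 3 (pair c (pair 0 0)))) (pair 0 0))

/-- The code of `φ` in terms of the code of `φ.ex`. -/
def exBody (c : ℕ) : ℕ := c.unpair.2.unpair.1.unpair.2.unpair.2.unpair.1

theorem exBody_exCode : Function.LeftInverse exBody exCode := fun c => by
  simp only [exBody, exCode, Nat.unpair_pair]

theorem code_exs {m : ℕ} (φ : LtP.BoundedFormula Empty m) :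
    code φ.exs = exCode^[m] (code φ) := by
  induction m with
  | zero => rfl
  | succ m ih => exact ih φ.ex

theorem lt_exCode (c : ℕ) : c < exCode c :=
  calc c ≤ pair c (pair 0 0) := Nat.left_le_pair _ _
    _ < pair 3 (pair c (pair 0 0)) := (Nat.lt_add_of_pos_left three_pos).trans_le
      (Nat.add_le_pair _ _)
    _ ≤ pair 4 _ := Nat.right_le_pair _ _
    _ ≤ pair _ (pair 0 0) := Nat.left_le_pair _ _
    _ ≤ pair 3 _ := Nat.right_le_pair _ _

theorem le_iterate_exCode (m c : ℕ) : m ≤ exCode^[m] c := by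
  induction m with
  | zero => exact Nat.zero_le _
  | succ m ih =>
    rw [Function.iterate_succ_apply']
    exact ih.trans_lt (lt_exCode _)

theorem exists_isQF_exs_eq {n : ℕ} {φ : LtP.BoundedFormula Empty n} (hφ : φ.IsExistential) :
    ∃ (m : ℕ) (ψ : LtP.BoundedFormula Empty m), ψ.IsQF ∧ φ.exs = ψ.exs := by
  induction hφ with
  | of_isQF h => exact ⟨_, _, h, rfl⟩
  | ex _ ih => exact ih

theorem isExistential_exs {n : ℕ} {φ : LtP.BoundedFormula Empty n} (hφ : φ.IsExistential) :
    BoundedFormula.IsExistential φ.exs := by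
  induction n with
  | zero => exact hφ
  | succ n ih => exact ih hφ.ex

/-- Whether `c` is the code of a sentence consisting of `k` existential quantifiers in front of a
quantifier-free formula. -/
def IsExsCode (c k : ℕ) : Prop := code (decodeFormula k (exBody^[k] c)).exs = c

instance (c k : ℕ) : Decidable (IsExsCode c k) := Nat.decEq _ _

/-- The number of existential quantifiers of the existential sentence with code `c`. -/
def existsDepth (c : ℕ) : ℕ := Nat.findGreatest (IsExsCode c) c

/-- The quantifier-free formula following the quantifiers of the existential sentence with code
`c`. -/
def matrix (c : ℕ) : LtP.BoundedFormula Empty (existsDepth c) :=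
  decodeFormula (existsDepth c) (exBody^[existsDepth c] c)

theorem isQF_matrix (c : ℕ) : (matrix c).IsQF := isQF_decodeFormula _ _

theorem isExsCode_existsDepth {φ : LtP.Sentence}
    (hφ : FirstOrder.Language.BoundedFormula.IsExistential φ) :
    IsExsCode (code φ) (existsDepth (code φ)) := by
  obtain ⟨m, ψ, hψ, h : φ = ψ.exs⟩ := exists_isQF_exs_eq hφ
  subst h
  refine Nat.findGreatest_spec (m := m) (code_exs ψ ▸ le_iterate_exCode m _) ?_
  rw [IsExsCode, code_exs ψ, exBody_exCode.iterate m, decodeFormula_code hψ, code_exs]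

theorem primrec₂_iterate_exBody : Primrec₂ fun c k => exBody^[k] c :=
  Primrec.nat_iterate .snd .fst (Primrec.comp (primrec_unpair_fst (primrec_unpair_snd
    (primrec_unpair_snd (primrec_unpair_fst (primrec_unpair_snd .id))))) .snd)

theorem primrecRel_isExsCode : PrimrecRel IsExsCode := by
  have hex : Primrec exCode := primrec_pair (.const 3) (primrec_pair (primrec_pair (.const 4)
    (primrec_pair (.const 3) (primrec_pair .id (.const _)))) (.const _))
  have hexs : Primrec₂ fun c k => code (decodeFormula k (exBody^[k] c)).exs :=
    (Primrec.nat_iterate (f := Prod.snd) (g := fun q : ℕ × ℕ =>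
      code (decodeFormula q.2 (exBody^[q.2] q.1))) .snd
      (primrec₂_code_decodeFormula.comp .snd primrec₂_iterate_exBody)
      (hex.comp₂ .right)).of_eq fun _ => (code_exs _).symm
  exact Primrec.eq.comp hexs .fst

theorem primrec_existsDepth : Primrec existsDepth :=
  Primrec.nat_findGreatest .id primrecRel_isExsCode

end LtP

namespace Lval

open Nat (pair)

variable {α : Type*} [Primcodable α]

/-- The code of `Formula.congr p a b` in terms of the codes of `a` and `b`. -/
def congrCode (p x y : ℕ) : ℕ :=
  pair 3 (pair (pair 2 (pair (pair 12 (pair 3 (pair x (pair 4 (pair (Term.numeral (p - 1)).code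
    y))))) (pair 12 (Term.numeral p).code))) (pair 0 0))

theorem primrec₂_congrCode (p : ℕ) : Primrec₂ (congrCode p) :=
  primrec_pair (.const 3) (primrec_pair (primrec_pair (.const 2) (primrec_pair
    (primrec_pair (.const 12) (primrec_pair (.const 3) (primrec_pair .fst
      (primrec_pair (.const 4) (primrec_pair (.const _) .snd)))))
    (.const _))) (.const _))

theorem primrec₂_code_liftFormula (p : ℕ) :
    Primrec₂ fun m c => (liftFormula p (LtP.decodeFormula m c)).code := by
  have hpair (k : ℕ) : Primrec₂ fun x y => pair k (pair x y) :=
    primrec_pair (.const k) (primrec_pair .fst .snd)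
  have hterm : Primrec₂ fun m c => (liftTerm (LtP.decodeTerm m c)).code :=
    LtP.primrec₂_fold_decodeTerm (F := fun τ => (liftTerm τ).code)
      (V := fun i => pair 0 (pair 0 i))
      (C := fun f => (liftTerm (m := 0) (.func f ![])).code)
      (A := fun f x y => match f with
        | .add => pair 3 (pair x y)
        | .mul => pair 4 (pair x y))
      (primrec_pair (.const 0) (primrec_pair (.const 0) .id))
      (fun f => match f with
        | .add => hpair 3
        | .mul => hpair 4)
      (fun _ => rfl) (fun f _ => by cases f <;> rfl) (fun f _ => by cases f <;> rfl)
  exact LtP.primrec₂_fold_decodeFormula (F := fun φ => (liftFormula p φ).code)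
    (R := fun x => congrCode p x (pair 14 (pair 12 x))) hterm (primrec₂_congrCode p)
    ((primrec₂_congrCode p).comp .id
      (primrec_pair (.const 14) (primrec_pair (.const 12) .id)))
    (hpair 3) rfl (fun _ _ => rfl) (fun _ => rfl) (fun _ _ => rfl)

/-- The code of `φ.conj ψ` in terms of the codes of `φ` and `ψ`. -/
def conjCode (x y : ℕ) : ℕ :=
  pair 3 (pair (pair 3 (pair x (pair 3 (pair y (pair 0 0))))) (pair 0 0))

theorem primrec₂_conjCode : Primrec₂ conjCode :=
  primrec_pair (.const 3) (primrec_pair (primrec_pair (.const 3) (primrec_pair .fst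
    (primrec_pair (.const 3) (primrec_pair .snd (.const _))))) (.const _))

theorem primrec_code_integral {m : α → ℕ} {φ : α → Formula} (hm : Primrec m)
    (hφ : Primrec fun a => (φ a).code) : Primrec fun a => ((φ a).integral (m a)).code := by
  have hvar : Primrec fun i : ℕ => (Formula.neg (.lt (.v (.var .K i)) .zeroΓ)).code :=
    primrec_pair (.const 3) (primrec_pair (primrec_pair (.const 2) (primrec_pair
      (primrec_pair (.const 12) (primrec_pair (.const 0) (primrec_pair (.const 0) .id)))
      (.const _))) (.const _))
  refine (Primrec.nat_rec' (h := fun _ q =>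
    conjCode (Formula.neg (.lt (.v (.var .K q.1)) .zeroΓ)).code q.2) hm hφ
    (primrec₂_conjCode.comp₂ (hvar.comp₂ (Primrec.fst.comp₂ .right))
      (Primrec.snd.comp₂ .right))).of_eq fun a => ?_
  induction m a with
  | zero => rfl
  | succ k ih => exact congrArg (conjCode _) ih

theorem primrec_code_exK {m : α → ℕ} {φ : α → Formula} (hm : Primrec m)
    (hφ : Primrec fun a => (φ a).code) : Primrec fun a => ((φ a).exK (m a)).code := by
  refine (Primrec.nat_rec' (h := fun _ q => pair 5 (pair (pair 0 q.1) q.2)) hm hφ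
    (primrec_pair (.const 5) (primrec_pair (primrec_pair (.const 0)
      (Primrec.fst.comp₂ .right)) (Primrec.snd.comp₂ .right)))).of_eq fun a => ?_
  induction m a with
  | zero => rfl
  | succ k ih => exact congrArg (fun y => pair 5 (pair (pair 0 k) y)) ih

theorem primrec_code_closure {m : α → ℕ} {φ : α → Formula} (hm : Primrec m)
    (hφ : Primrec fun a => (φ a).code) : Primrec fun a => ((φ a).closure (m a)).code :=
  primrec_pair (.const 5) <| primrec_pair (.const _) <| primrec_code_exK
    (φ := fun a => .all .Γ 1 (Formula.leastPos.conj ((φ a).integral (m a)))) hm <|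
    primrec_pair (.const 4) <| primrec_pair (.const _) <|
    primrec₂_conjCode.comp (.const _) (primrec_code_integral hm hφ)

/-- The reduction on codes: the code of an existential sentence is sent to the code of its
translation, any other number to the code of `⊥`. -/
def reduction (p c : ℕ) : ℕ :=
  if LtP.IsExsCode c (LtP.existsDepth c) then
    ((liftFormula p (LtP.matrix c)).closure (LtP.existsDepth c)).code
  else Formula.falsum.code

theorem primrec_reduction (p : ℕ) : Primrec (reduction p) :=
  Primrec.ite (LtP.primrecRel_isExsCode.comp .id LtP.primrec_existsDepth)
    (primrec_code_closure LtP.primrec_existsDepth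
      ((primrec₂_code_liftFormula p).comp LtP.primrec_existsDepth
        (LtP.primrec₂_iterate_exBody.comp .id LtP.primrec_existsDepth)))
    (.const _)

end Lval

section Reduction

open Lval PadicExt Filter

variable {p : ℕ} [Fact p.Prime]

theorem falsum_notMem_asymptoticExistsForallTheory (s : (K : TotRam p) → CrossSection K.1) :
    Formula.falsum ∉ asymptoticExistsForallTheory s := by
  rintro ⟨-, -, h⟩
  have hfalse : ∀ᶠ _K : TotRam p in cofinite, False :=
    h.mono fun _ hK => hK (Classical.arbitrary _)
  rw [eventually_totRam_finrank_iff (P := fun _ => False)] at hfalse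
  exact hfalse.exists.elim fun _ => id

theorem closure_liftFormula_mem_iff (s : (K : TotRam p) → CrossSection K.1) {m : ℕ}
    {φ : LtP.BoundedFormula Empty m} (hφ : φ.IsQF) :
    (liftFormula p φ).closure m ∈ asymptoticExistsForallTheory s ↔
      φ.exs ∈ asymptoticExistentialTheory p := by
  have hmodels : (∀ᶠ K : TotRam p in cofinite,
      (padicStr K.1 (s K)).Models ((liftFormula p φ).closure m)) ↔
        ∀ᶠ n in cofinite, TruncPoly p n ⊨ φ.exs := by
    simp only [fun K : TotRam p => (s K).models_closure_liftFormula_iff K.2 hφ]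
    exact eventually_totRam_finrank_iff (P := fun n => TruncPoly p n ⊨ φ.exs)
  exact ⟨fun h => ⟨LtP.isExistential_exs hφ.isExistential, hmodels.1 h.2.2⟩,
    fun h => ⟨Formula.isSentence_closure (freeVars_liftFormula p φ),
      (isQF_liftFormula p φ).isExistsForall_closure m, hmodels.2 h.2⟩⟩

theorem reduction_mem_iff (s : (K : TotRam p) → CrossSection K.1) (c : ℕ) :
    reduction p c ∈ Formula.code '' asymptoticExistsForallTheory s ↔
      c ∈ LtP.code '' asymptoticExistentialTheory p := by
  by_cases hc : LtP.IsExsCode c (LtP.existsDepth c)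
  · have hcode : LtP.code (LtP.matrix c).exs = c := hc
    rw [reduction, if_pos hc, Formula.code_inj.mem_set_image,
      closure_liftFormula_mem_iff s (LtP.isQF_matrix c), ← LtP.code_inj.mem_set_image, hcode]
  · rw [reduction, if_neg hc, Formula.code_inj.mem_set_image]
    refine iff_of_false (falsum_notMem_asymptoticExistsForallTheory s) ?_
    rintro ⟨φ, ⟨hφ, -⟩, rfl⟩
    exact hc (LtP.isExsCode_existsDepth hφ)

theorem asymptoticExistentialTheory_manyOneReducible (s : (K : TotRam p) → CrossSection K.1) :
    (· ∈ LtP.code '' asymptoticExistentialTheory p) ≤₀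
      (· ∈ Formula.code '' asymptoticExistsForallTheory s) :=
  ⟨reduction p, (primrec_reduction p).to_comp, fun c => (reduction_mem_iff s c).symm⟩

theorem turingReducible_charFun_of_manyOneReducible {A B : Set ℕ} (h : (· ∈ A) ≤₀ (· ∈ B)) :
    TuringReducible (charFun A) (charFun B) := by
  classical
  obtain ⟨f, hf, hAB⟩ := h
  have hrec : Nat.RecursiveIn {charFun B} (f : ℕ →. ℕ) :=
    RecursiveIn.iff_nat.1 (Partrec.recursiveIn hf)
  have hcomp := (Nat.RecursiveIn.oracle (charFun B) (Set.mem_singleton _)).comp hrec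
  refine RecursiveIn.iff_nat.2 (hcomp.of_eq fun c => ?_)
  refine (Part.bind_some (f c) (charFun B)).trans ?_
  simp [charFun, Set.indicator_apply, hAB]

end Reduction

theorem corollary2p5 (p : ℕ) [Fact p.Prime]
    (s : (K : PadicExt.TotRam p) → PadicExt.CrossSection K.1) :
    TuringReducible
      (charFun (LtP.code '' asymptoticExistentialTheory p))
      (charFun (Lval.Formula.code '' PadicExt.asymptoticExistsForallTheory s)) :=
  turingReducible_charFun_of_manyOneReducible (asymptoticExistentialTheory_manyOneReducible s)
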